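/- **Setting.** Let $D=\mathbb{R}$ or $D=\mathbb{R}^+=(0,\infty)$, and let $F:D\to\mathbb{R}$ be a warping function: $F$ is a $C^1$ bijection with $F'>0$, with $F'(t_1)\le F'(t_0)$ whenever $|t_0|<|t_1|$, odd if $D=\mathbb{R}$, and such that $w:=(F^{-1})'$ satisfies $w(x+y)\le C\,v(x)w(y)$ for all $x,y\in\mathbb{R}$, for some constant $C$ and some $v:\mathbb{R}\to\mathbb{R}^+$ with $v(x+y)\le v(x)v(y)$. Write $L^2_{\sqrt w}=\{\theta:\sqrt w\,\theta\in L^2(\mathbb{R})\}$. Let $X=D\times\mathbb{R}$ with Lebesgue measure $\mu$, and $\mathcal H=\mathcal F^{-1}(L^2(D))\subseteq L^2(\mathbb{R})$. For $\theta\in L^2_{\sqrt w}\cap L^2$ put $$g_{x,\xi}=T_\xi\mathcal F^{-1}g_x,\qquad g_x=\sqrt{F'(x)}\,\theta(F(\cdot)-F(x))\ \text{ on } D,\qquad \mathcal G(\theta,F)=\{g_{x,\xi}\}_{(x,\xi)\in X},$$ $V_{\theta,F}f(p)=\langle f,g_p\rangle$ for $p\in X$, and $K_{\theta,F}(p,q)=A_\theta^{-1}\langle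 g_q,g_p\rangle$ with $A_\theta=\|\theta\|_{L^2}^2$. For two prototypes, with atoms $g^1_p$ and $g^2_p$, put $K_{\theta_1,\theta_2,F}(p,q)=\langle g^2_q,g^1_p\rangle$. Let $m:X\times X\to\mathbb{R}$ be an admissible weight: $m$ is measurable, $1\le m(p,q)\le m(p,r)m(r,q)$, $m(p,q)=m(q,p)$, and $m(p,p)\le C$. $\mathcal A_m$ is the space of measurable kernels $K$ on $X\times X$ with $$\|K\|_{\mathcal A_m}=\max\Big\{\operatorname*{ess\,sup}_{p}\int_X|K(p,q)|\,m(p,q)\,d\mu(q),\ \operatorname*{ess\,sup}_{q}\int_X|K(p,q)|\,m(p,q)\,d\mu(p)\Big\}<\infty ,$$ with product $(K_1\circ K_2)(p,q)=\int_X K_1(p,r)K_2(r,q)\,d\mu(r)$ and action $K(G)(p)=\int_X K(p,q)G(q)\,d\mu(q)$. A solid Banach space $Y$ is a nontrivial Banach space of (a.e. classes of) functions on $X$, continuously embedded in $L^1_{loc}(X)$, such that $G\in L^1_{loc}(X)$, $H\in Y$ and $|G|\le|H|$ a.e. imply $G\in Y$ and $\|G\|_Y\le\|H\|_Y$. Fix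 $z\in X$ and put $v_z=m(\cdot,z)$, $\mathcal H^1_{v_z}(\theta)=\{f\in\mathcal H:V_{\theta,F}f\in L^1_{v_z}\}$ with norm $\|V_{\theta,F}f\|_{L^1_{v_z}}$. For an element $f$ of the anti-dual $\mathcal H^1_{v_z}(\theta)^*$ (the bounded conjugate-linear functionals) put $V_{\theta,F}f(p)=f(g_p)$, which is defined for almost every $p$ if $K_{\theta,F}\in\mathcal A_m$, and let $$\mathrm{Co}(\mathcal G(\theta,F),Y)=\{f\in\mathcal H^1_{v_z}(\theta)^*:V_{\theta,F}f\in Y\},\qquad \|f\|=\|V_{\theta,F}f\|_Y .$$ **Proposition.** Let $\theta_1,\theta_2\in L^2_{\sqrt w}(\mathbb{R})\cap L^2(\mathbb{R})$ with $K_{\theta_1,F},K_{\theta_2,F}\in\mathcal A_m$. Assume that $\langle\theta_1,\theta_2\rangle\ne0$ or, more generally, that there is some $\theta_0\in L^2_{\sqrt w}(\mathbb{R})\cap L^2(\mathbb{R})$ with $K_{\theta_0,F}\in\mathcal A_m$, $\langle\theta_1,\theta_0\rangle\neq0$ and $\langle\theta_0,\theta_2\rangle\ne0$. Then $$\langle\theta_1,\theta_2\rangle\,K_{\theta_1,\theta_2,F}=A_{\theta_1}A_{\theta_2}\;K_{\theta_1,F}\circ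 K_{\theta_2,F}\quad\text{pointwise on } X\times X,\qquad\text{and}\qquad K_{\theta_1,\theta_2,F}\in\mathcal A_m .$$ Moreover, let $Y$ be a solid Banach space such that for all $K\in\mathcal A_m$ and $G\in Y$ the integral $K(G)(p)$ converges absolutely for almost every $p$, $K(G)\in Y$, and $\|K(G)\|_Y\le\|K\|_{\mathcal A_m}\|G\|_Y$. Then, for every $z\in X$, $\mathrm{Co}(\mathcal G(\theta_1,F),Y)=\mathrm{Co}(\mathcal G(\theta_2,F),Y)$ as sets of functionals (with the same domain), and their norms are equivalent. -/

import Mathlib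

open MeasureTheory
open scoped FourierTransform ComplexConjugate

noncomputable section

namespace WarpedCoorbit

/-! ### Weighted kernel algebras -/

section Kernels

variable {X : Type*} [MeasurableSpace X]

/-- Admissible weights `m` on `X × X`. -/
structure IsAdmissibleWeight (m : X → X → ℝ) : Prop where
  measurable : Measurable (Function.uncurry m)
  one_le : ∀ x y, 1 ≤ m x y
  le_mul : ∀ x y z, m x y ≤ m x z * m z y
  symm : ∀ x y, m x y = m y x
  diag_bdd : ∃ C : ℝ, ∀ x, m x x ≤ C

/-- The norm of the weighted kernel algebra `𝒜_m`, with values in `[0, ∞]`. -/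
def kernelNorm (μ : Measure X) (m : X → X → ℝ) (K : X → X → ℂ) : ENNReal :=
  max (essSup (fun x => ∫⁻ y, ‖K x y‖ₑ * ENNReal.ofReal (m x y) ∂μ) μ)
    (essSup (fun y => ∫⁻ x, ‖K x y‖ₑ * ENNReal.ofReal (m x y) ∂μ) μ)

/-- `K ∈ 𝒜_m`. -/
def MemKernelAlgebra (μ : Measure X) (m : X → X → ℝ) (K : X → X → ℂ) : Prop :=
  AEStronglyMeasurable (Function.uncurry K) (μ.prod μ) ∧ kernelNorm μ m K < ⊤

/-- The multiplication of kernels. -/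
def kernelComp (μ : Measure X) (K₁ K₂ : X → X → ℂ) (x y : X) : ℂ :=
  ∫ z, K₁ x z * K₂ z y ∂μ

/-- The application `K(G)` of a kernel to a function. -/
def kernelApply (μ : Measure X) (K : X → X → ℂ) (G : X → ℂ) (x : X) : ℂ :=
  ∫ y, K x y * G y ∂μ

end Kernels

/-! ### Solid Banach function spaces -/

section Solid

variable {X : Type*} [MeasurableSpace X] [TopologicalSpace X] {μ : Measure X}
  {Y : Type*} [NormedAddCommGroup Y] [NormedSpace ℂ Y]

/-- The Banach space `Y`, realised through the linear map `ι` as a space of (classes of)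
functions on `X`, is nontrivial, continuously embedded in `L¹_loc`, and solid. -/
structure IsSolidSpace (ι : Y →ₗ[ℂ] (X →ₘ[μ] ℂ)) : Prop where
  complete : CompleteSpace Y
  nontrivial : Nontrivial Y
  injective : Function.Injective ι
  locallyIntegrable : ∀ G : Y, LocallyIntegrable (ι G) μ
  embedding : ∀ Q : Set X, IsCompact Q → ∃ C : ℝ, ∀ G : Y, ∫ x in Q, ‖ι G x‖ ∂μ ≤ C * ‖G‖
  solid : ∀ (G : X →ₘ[μ] ℂ) (H : Y), LocallyIntegrable G μ →
    (∀ᵐ x ∂μ, ‖G x‖ ≤ ‖ι H x‖) → ∃ G' : Y, ι G' = G ∧ ‖G'‖ ≤ ‖H‖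

/-- `𝒜_m(Y) ⊆ Y` with `‖K(G)‖_Y ≤ ‖K‖_{𝒜_m} ‖G‖_Y`. -/
def KernelAlgebraActs (m : X → X → ℝ) (ι : Y →ₗ[ℂ] (X →ₘ[μ] ℂ)) : Prop :=
  ∀ K : X → X → ℂ, MemKernelAlgebra μ m K → ∀ G : Y,
    (∀ᵐ x ∂μ, Integrable (fun y => K x y * ι G y) μ) ∧
    ∃ H : Y, ι H =ᵐ[μ] kernelApply μ K (ι G) ∧ ‖H‖ ≤ (kernelNorm μ m K).toReal * ‖G‖

end Solid

/-! ### Coorbit spaces of a family `ψ` in a subspace `𝓗` of a Hilbert space -/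

section Coorbit

variable {X : Type*} [MeasurableSpace X] (μ : Measure X)
  {E : Type*} [NormedAddCommGroup E] [InnerProductSpace ℂ E]

/-- The kernel `A⁻¹⟨ψ_y, ψ_x⟩` of a tight frame with bound `A`. -/
def frameKernel (A : ℝ) (ψ : X → E) (x y : X) : ℂ := (A : ℂ)⁻¹ * inner ℂ (ψ x) (ψ y)

/-- The mixed kernel `⟨ψ'_y, ψ_x⟩`. -/
def mixedKernel (ψ ψ' : X → E) (x y : X) : ℂ := inner ℂ (ψ x) (ψ' y)

/-- `𝓗¹_v = {f ∈ 𝓗 : V_ψ f ∈ L¹_v}` with `v = m(·, z)`. -/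
def testSpace (𝓗 : Submodule ℂ E) (ψ : X → E) (m : X → X → ℝ) (z : X) : Submodule ℂ E where
  carrier := {f | f ∈ 𝓗 ∧ Integrable (fun x => (m x z : ℂ) * inner ℂ (ψ x) f) μ}
  zero_mem' := ⟨𝓗.zero_mem, by simp⟩
  add_mem' := by
    rintro f g ⟨hf, hf'⟩ ⟨hg, hg'⟩
    refine ⟨𝓗.add_mem hf hg, ?_⟩
    have h := hf'.add hg'
    refine h.congr (Filter.Eventually.of_forall fun x => ?_)
    simp only [Pi.add_apply, inner_add_right, mul_add]
  smul_mem' := by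
    rintro c f ⟨hf, hf'⟩
    refine ⟨𝓗.smul_mem c hf, ?_⟩
    simpa only [inner_smul_right, mul_left_comm] using hf'.const_mul c

/-- The norm `‖V_ψ f‖_{L¹_v}` of `𝓗¹_v`. -/
def testNorm (ψ : X → E) (m : X → X → ℝ) (z : X) (f : E) : ℝ :=
  ∫ x, m x z * ‖(inner ℂ (ψ x) f : ℂ)‖ ∂μ

/-- Conjugate-linear functionals, each together with the subspace on which it is defined. -/
abbrev AntiFunctional (E : Type*) [NormedAddCommGroup E] [InnerProductSpace ℂ E] :=
  Σ S : Submodule ℂ E, (S →ₛₗ[starRingEnd ℂ] ℂ)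

open Classical in
/-- The extended transform `V_ψ T (x) = T(ψ_x)`. If `ψ` has its kernel in `𝒜_m`, then `ψ_x` lies
in `𝓗¹_v` for almost every `x`; the value `0` is used off the domain of `T`. -/
def voice (ψ : X → E) (T : AntiFunctional E) (x : X) : ℂ :=
  if h : ψ x ∈ T.1 then T.2 ⟨ψ x, h⟩ else 0

/-- `Co(ψ, Y)`: all `T` in the anti-dual of `𝓗¹_v` with `V_ψ T ∈ Y`. -/
def coorbit {μ : Measure X} {Y : Type*} [NormedAddCommGroup Y] [NormedSpace ℂ Y]
    (𝓗 : Submodule ℂ E) (ψ : X → E) (m : X → X → ℝ) (z : X) (ι : Y →ₗ[ℂ] (X →ₘ[μ] ℂ)) :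
    Set (AntiFunctional E) :=
  {T | T.1 = testSpace μ 𝓗 ψ m z ∧
    (∃ C : ℝ, ∀ f : T.1, ‖T.2 f‖ ≤ C * testNorm μ ψ m z (f : E)) ∧
    ∃ G : Y, ι G =ᵐ[μ] voice ψ T}

end Coorbit

/-! ### Warped time-frequency systems -/

/-- A submultiplicative weight on `ℝ`. -/
def IsSubmultiplicative (v : ℝ → ℝ) : Prop :=
  (∀ x, 0 < v x) ∧ ∀ x y, v (x + y) ≤ v x * v y

/-- A `v`-moderate function on `ℝ`. -/
def IsModerate (v w : ℝ → ℝ) : Prop :=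
  ∃ C : ℝ, ∀ x y, w (x + y) ≤ C * v x * w y

/-- The weight `w = (F⁻¹)' = 1 / F'(F⁻¹(·))` of a bijection `F : D → ℝ`. -/
def warpWeight (D : Set ℝ) (F : ℝ → ℝ) (t : ℝ) : ℝ :=
  (deriv F (Function.invFunOn F D t))⁻¹

/-- Warping functions `F : D → ℝ` for `D = ℝ` or `D = (0, ∞)`; only the values on `D` matter. -/
structure IsWarpingFunction (D : Set ℝ) (F : ℝ → ℝ) : Prop where
  domain : D = Set.univ ∨ D = Set.Ioi 0
  bijOn : Set.BijOn F D Set.univ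
  contDiffOn : ContDiffOn ℝ 1 F D
  deriv_pos : ∀ t ∈ D, 0 < deriv F t
  deriv_anti : ∀ s ∈ D, ∀ t ∈ D, |s| < |t| → deriv F t ≤ deriv F s
  moderate : ∃ v : ℝ → ℝ, IsSubmultiplicative v ∧ IsModerate v (warpWeight D F)
  odd : D = Set.univ → ∀ t, F (-t) = -F t

/-- `θ ∈ L²_{√w}(ℝ) ∩ L²(ℝ)`. -/
def IsPrototype (D : Set ℝ) (F : ℝ → ℝ) (θ : ℝ → ℂ) : Prop :=
  MemLp (fun t => (Real.sqrt (warpWeight D F t) : ℂ) * θ t) 2 volume ∧ MemLp θ 2 volume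

/-- `L²(ℝ)`. -/
abbrev L2 := Lp ℂ 2 (volume : Measure ℝ)

/-- The Hilbert space `ℱ⁻¹(L²(D))`. -/
def bandSpace (D : Set ℝ) : Submodule ℂ L2 where
  carrier := {f | ∀ᵐ t : ℝ, t ∉ D → (𝓕 f : L2) t = 0}
  zero_mem' := by
    have h0 : (𝓕 (0 : L2) : L2) = 0 := (Lp.fourierTransformₗᵢ ℝ ℂ).map_zero
    simp only [Set.mem_ofPred_eq, h0]
    filter_upwards [Lp.coeFn_zero ℂ 2 (volume : Measure ℝ)] with t ht _
    rw [ht, Pi.zero_apply]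
  add_mem' := by
    intro f g hf hg
    have h : (𝓕 (f + g) : L2) = 𝓕 f + 𝓕 g := (Lp.fourierTransformₗᵢ ℝ ℂ).map_add f g
    simp only [Set.mem_ofPred_eq, h] at hf hg ⊢
    filter_upwards [Lp.coeFn_add (𝓕 f : L2) (𝓕 g : L2), hf, hg] with t ht h1 h2 hD
    rw [ht, Pi.add_apply, h1 hD, h2 hD, add_zero]
  smul_mem' := by
    intro c f hf
    have h : (𝓕 (c • f) : L2) = c • 𝓕 f := (Lp.fourierTransformₗᵢ ℝ ℂ).map_smul c f
    simp only [Set.mem_ofPred_eq, h] at hf ⊢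
    filter_upwards [Lp.coeFn_smul c (𝓕 f : L2), hf] with t ht h1 hD
    rw [ht, Pi.smul_apply, h1 hD, smul_zero]

/-- `g_x = √F'(x) · (T_{F(x)} θ) ∘ F` on `D`, extended by zero. -/
def warpedWindow (D : Set ℝ) (F : ℝ → ℝ) (θ : ℝ → ℂ) (x : ℝ) : ℝ → ℂ :=
  D.indicator fun t => (Real.sqrt (deriv F x) : ℂ) * θ (F t - F x)

/-- The translation `T_ξ f = f(· - ξ)` on `L²(ℝ)`. -/
def translate (ξ : ℝ) (f : L2) : L2 :=
  Lp.compMeasurePreserving (fun t : ℝ => t - ξ) (measurePreserving_sub_right volume ξ) f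

open Classical in
/-- The atoms `g_{x,ξ} = T_ξ ℱ⁻¹ g_x` of `𝒢(θ, F)`. For a warping function `F` and
`θ ∈ L²_{√w}(ℝ)` the windows `g_x` are always in `L²(ℝ)`. -/
def warpedAtom (D : Set ℝ) (F : ℝ → ℝ) (θ : ℝ → ℂ) (p : D × ℝ) : L2 :=
  if h : MemLp (warpedWindow D F θ p.1) 2 (volume : Measure ℝ) then
    translate p.2 (𝓕⁻ (h.toLp _))
  else 0

/-- The (unweighted) inner product `⟨θ, η⟩ = ∫ θ η̄`. -/
def l2Inner (θ η : ℝ → ℂ) : ℂ := ∫ t, θ t * conj (η t)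

/-- The frame bound `‖θ‖²_{L²}` of the tight frame `𝒢(θ, F)`. -/
def frameBound (θ : ℝ → ℂ) : ℝ := ∫ t, ‖θ t‖ ^ 2

/-- Lebesgue measure on the phase space `D × ℝ`. -/
def phaseMeasure (D : Set ℝ) : Measure (D × ℝ) :=
  (Measure.comap ((↑) : D → ℝ) volume).prod volume

/-- `K_{θ,F}`. -/
def warpedKernel (D : Set ℝ) (F : ℝ → ℝ) (θ : ℝ → ℂ) : D × ℝ → D × ℝ → ℂ :=
  frameKernel (frameBound θ) (warpedAtom D F θ)

/-- `K_{θ₁,θ₂,F}`. -/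
def warpedMixedKernel (D : Set ℝ) (F : ℝ → ℝ) (θ₁ θ₂ : ℝ → ℂ) : D × ℝ → D × ℝ → ℂ :=
  mixedKernel (warpedAtom D F θ₁) (warpedAtom D F θ₂)

end WarpedCoorbit

end

open WarpedCoorbit

noncomputable section

namespace WarpedCoorbit

/-! Everything rests on the orthogonality relations (`orthogonality`): for `h` in the band space and
`f` in `L²`, integrating `inner h g¹_p * inner g²_p f` over phase space gives `⟨θ₁, θ₂⟩` times
`inner h f`. For fixed `x` the coefficient `ξ ↦ inner h g_{x,ξ}` is the Fourier transform of `g_x ·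
conj (𝓕 h)`, so Plancherel removes `ξ`. The remaining `x`-integral of `g¹_x(t) conj (g²_x(t))`
carries the factor `F'(x)`, which is exactly the Jacobian of `s = F(x)`. It therefore equals `⟨θ₁,
θ₂⟩` for every `t ∈ D`.

Taking atoms for `h` and `f` gives the pointwise composition formula. Taking equal prototypes shows
that a nonzero prototype generates a tight frame with bound `‖θ‖²`. Submultiplicativity of `m` makes
`𝒜_m` stable under composition (`MemKernelAlgebra.of_le_comp`), so a nonzero inner product puts the
mixed kernel in `𝒜_m`. In general `K_{1,0}` and `K_{0,2}` are in `𝒜_m` by this argument, and the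
tight frame of `θ₀` composes them into `K_{1,2}`.

The coorbit statement is abstract (`coorbit_eq_and_norm_equiv`). For tight families with mixed
kernel in `𝒜_m`, a weighted Schur test shows that the test spaces agree with equivalent norms. For a
bounded functional `T`, the relation `V₂ T = A₁⁻¹ K₂₁ (V₁ T)` holds almost everywhere, and `𝒜_m`
acts boundedly on `Y`. This relation comes from writing a test vector as a Bochner integral of atoms
and moving `T` inside (`IsTightFamily.functional_eq_integral`). No completeness of the test space is
needed, since it embeds isometrically in `L¹` and `T` extends there by Hahn–Banach. -/

/-! ### Families in `Lᵖ` depending measurably on a parameter -/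

section LpValued

variable {X Z : Type*} [MeasurableSpace X] [MeasurableSpace Z]

/-- A map into a second countable metric space is strongly measurable as soon as the distances to
all fixed points are measurable. -/
lemma stronglyMeasurable_of_dist {M : Type*} [PseudoMetricSpace M] [SecondCountableTopology M]
    {g : Z → M} (h : ∀ c, Measurable fun y => dist (g y) c) : StronglyMeasurable g := by
  borelize M
  rw [stronglyMeasurable_iff_measurable]
  refine measurable_of_isOpen fun U hU => ?_
  choose! r hr hrU using Metric.isOpen_iff.1 hU
  have hU' : U = ⋃ x : U, Metric.ball (x : M) (r x) := by
    refine Set.Subset.antisymm (fun x hx => ?_) (Set.iUnion_subset fun x => hrU x x.2)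
    exact Set.mem_iUnion.2 ⟨⟨x, hx⟩, Metric.mem_ball_self (hr x hx)⟩
  -- Lindelöf: countably many of the balls suffice, and the preimage of a ball is a sublevel set of
  -- a distance function.
  obtain ⟨T, hT, hTU⟩ := TopologicalSpace.isOpen_iUnion_countable
    (fun x : U => Metric.ball (x : M) (r x)) fun _ => Metric.isOpen_ball
  rw [hU', ← hTU, Set.preimage_iUnion₂]
  refine MeasurableSet.biUnion hT fun x _ => ?_
  exact measurableSet_lt (h x) measurable_const

lemma stronglyMeasurable_toLp {μ : Measure X} [SFinite μ] [IsSeparable μ] {p : ENNReal}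
    [Fact (1 ≤ p)] [hp : Fact (p ≠ ⊤)] {f : Z → X → ℂ}
    (hf : StronglyMeasurable (Function.uncurry f)) (h : ∀ y, MemLp (f y) p μ) :
    StronglyMeasurable fun y => (h y).toLp (f y) := by
  have hp0 : p ≠ 0 := (lt_of_lt_of_le zero_lt_one (Fact.out : 1 ≤ p)).ne'
  refine stronglyMeasurable_of_dist fun c => ?_
  -- With a genuinely measurable representative of `c`, the distance to `c` is a parameter integral
  -- of a jointly measurable function.
  obtain ⟨c', hc', hcc⟩ := (Lp.aestronglyMeasurable c)
  have hcL : MemLp c' p μ := (memLp_congr_ae hcc).1 (Lp.memLp c)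
  have hc : c = hcL.toLp c' := by
    rw [← Lp.toLp_coeFn c (Lp.memLp c)]
    exact (MemLp.toLp_eq_toLp_iff _ _).2 hcc
  have : (fun y => dist ((h y).toLp (f y)) c) = fun y =>
      ((∫⁻ x, ‖f y x - c' x‖ₑ ^ p.toReal ∂μ) ^ (1 / p.toReal)).toReal := by
    ext y
    rw [hc, dist_eq_norm, ← MemLp.toLp_sub, Lp.norm_toLp,
      eLpNorm_eq_lintegral_rpow_enorm_toReal hp0 hp.out]
    rfl
  rw [this]
  have hm : Measurable fun q : Z × X => ‖f q.1 q.2 - c' q.2‖ₑ ^ p.toReal :=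
    ((hf.sub (hc'.comp_measurable measurable_snd)).enorm).pow_const _
  exact (hm.lintegral_prod_right'.pow_const _).ennreal_toReal

/-- The Bochner integral of an `L¹`-valued function is computed pointwise. -/
lemma integrable_and_coeFn_integral_L1 {μ : Measure X} [SFinite μ] [IsSeparable μ]
    {ν : Measure Z} [SFinite ν] {f : Z → X → ℂ} (hf : StronglyMeasurable (Function.uncurry f))
    (hfi : Integrable (Function.uncurry f) (ν.prod μ)) {g : Z → Lp ℂ 1 μ}
    (hg : ∀ᵐ y ∂ν, g y =ᵐ[μ] f y) :
    Integrable g ν ∧ (∫ y, g y ∂ν : Lp ℂ 1 μ) =ᵐ[μ] fun x => ∫ y, f y x ∂ν := by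
  have : Fact ((1 : ENNReal) ≠ ⊤) := ⟨ENNReal.one_ne_top⟩
  -- Only almost every slice `f y` is integrable; cutting off outside `S` puts every slice in `L¹`.
  set S : Set Z := {y | ∫⁻ x, ‖f y x‖ₑ ∂μ < ⊤} with hS
  have hSm : MeasurableSet S := measurableSet_lt
    (Measurable.lintegral_prod_right' (f := fun q : Z × X => ‖f q.1 q.2‖ₑ) hf.enorm)
    measurable_const
  set f' : Z → X → ℂ := S.indicator f with hf'
  have hf'm : StronglyMeasurable (Function.uncurry f') := by
    have : Function.uncurry f' = (Prod.fst ⁻¹' S).indicator (Function.uncurry f) := by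
      ext ⟨y, x⟩
      by_cases hy : y ∈ S <;> simp [f', hy, Function.uncurry, Set.indicator]
    rw [this]
    exact hf.indicator (measurable_fst hSm)
  have hfy : ∀ y, StronglyMeasurable (f y) := fun y => hf.comp_measurable measurable_prodMk_left
  have hf'L : ∀ y, MemLp (f' y) 1 μ := by
    intro y
    by_cases hy : y ∈ S
    · rw [hf', Set.indicator_of_mem hy, memLp_one_iff_integrable]
      exact ⟨(hfy y).aestronglyMeasurable, hy⟩
    · rw [hf', Set.indicator_of_notMem hy]
      exact MemLp.zero
  have hgm : AEStronglyMeasurable g ν := by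
    refine ⟨_, stronglyMeasurable_toLp hf'm hf'L, ?_⟩
    filter_upwards [hg, hfi.prod_right_ae] with y hy hyi
    have hyS : y ∈ S := hyi.2
    refine Lp.ext (hy.trans ?_)
    have hfy' : f' y = f y := Set.indicator_of_mem hyS f
    exact ((hf'L y).coeFn_toLp.trans (by rw [hfy'])).symm
  have hgi : Integrable g ν := by
    refine (hfi.integral_norm_prod_left).mono' hgm ?_
    filter_upwards [hg] with y hy
    rw [L1.norm_eq_integral_norm]
    exact (integral_congr_ae (hy.mono fun x hx => by simp only [hx]; rfl)).le
  refine ⟨hgi, ?_⟩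
  refine Integrable.ae_eq_of_forall_setIntegral_eq _ _ (L1.integrable_coeFn _)
    hfi.integral_prod_right fun s hs _ => ?_
  -- Integration over `s` is a continuous functional on `L¹`, so it commutes with the Bochner
  -- integral; Fubini handles the pointwise side.
  let R : Lp ℂ 1 μ →L[ℝ] ℂ :=
    (L1.integralCLM (μ := μ.restrict s) (E := ℂ)).comp (LpToLpRestrictCLM X ℂ ℝ μ 1 s)
  have hRa : ∀ u : Lp ℂ 1 μ, R u = ∫ x in s, u x ∂μ := by
    intro u
    have : R u = L1.integral (LpToLpRestrictCLM X ℂ ℝ μ 1 s u) := by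
      rw [L1.integral_eq]; rfl
    rw [this, L1.integral_eq_integral]
    exact integral_congr_ae (LpToLpRestrictCLM_coeFn ℝ s u)
  have hfs : Integrable (Function.uncurry f) (ν.prod (μ.restrict s)) := by
    have := hfi.integrableOn (s := Set.univ ×ˢ s)
    rwa [IntegrableOn, ← Measure.prod_restrict, Measure.restrict_univ] at this
  rw [← hRa, ← R.integral_comp_comm hgi, ← integral_integral_swap hfs]
  refine integral_congr_ae ?_
  filter_upwards [hg] with y hy
  rw [hRa]
  exact integral_congr_ae (ae_restrict_of_ae hy)

end LpValued

/-! ### Composition in the weighted kernel algebra -/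

section KernelAlgebra

variable {X : Type*} [MeasurableSpace X] {μ : Measure X} {m : X → X → ℝ}

/-- The weighted modulus `|K| m` of a kernel. -/
def weightedModulus (m : X → X → ℝ) (K : X → X → ℂ) (x y : X) : ENNReal :=
  ‖K x y‖ₑ * ENNReal.ofReal (m x y)

lemma IsAdmissibleWeight.pos (hm : IsAdmissibleWeight m) (x y : X) : 0 < m x y :=
  lt_of_lt_of_le one_pos (hm.one_le x y)

lemma IsAdmissibleWeight.ofReal_le_mul (hm : IsAdmissibleWeight m) (x y z : X) :
    ENNReal.ofReal (m x y) ≤ ENNReal.ofReal (m x z) * ENNReal.ofReal (m z y) := by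
  rw [← ENNReal.ofReal_mul (hm.pos x z).le]
  exact ENNReal.ofReal_le_ofReal (hm.le_mul x y z)

lemma measurable_weightedModulus (hm : IsAdmissibleWeight m) {K : X → X → ℂ}
    (hK : StronglyMeasurable (Function.uncurry K)) :
    Measurable (Function.uncurry (weightedModulus m K)) :=
  hK.enorm.mul hm.measurable.ennreal_ofReal

lemma ae_lintegral_right_le (K : X → X → ℂ) :
    ∀ᵐ x ∂μ, ∫⁻ y, weightedModulus m K x y ∂μ ≤ kernelNorm μ m K := by
  filter_upwards [ENNReal.ae_le_essSup
    (fun x => ∫⁻ y, ‖K x y‖ₑ * ENNReal.ofReal (m x y) ∂μ)] with x hx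
  exact hx.trans (le_max_left _ _)

lemma ae_lintegral_left_le (K : X → X → ℂ) :
    ∀ᵐ y ∂μ, ∫⁻ x, weightedModulus m K x y ∂μ ≤ kernelNorm μ m K := by
  filter_upwards [ENNReal.ae_le_essSup
    (fun y => ∫⁻ x, ‖K x y‖ₑ * ENNReal.ofReal (m x y) ∂μ)] with y hy
  exact hy.trans (le_max_right _ _)

lemma kernelNorm_le {K : X → X → ℂ} {N : ENNReal}
    (h₁ : ∀ᵐ x ∂μ, ∫⁻ y, weightedModulus m K x y ∂μ ≤ N)
    (h₂ : ∀ᵐ y ∂μ, ∫⁻ x, weightedModulus m K x y ∂μ ≤ N) : kernelNorm μ m K ≤ N :=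
  max_le (essSup_le_of_ae_le _ h₁) (essSup_le_of_ae_le _ h₂)

/-- The swapped kernel with conjugated entries has the same norm. -/
lemma MemKernelAlgebra.conj_swap [SFinite μ] (hm : IsAdmissibleWeight m) {K : X → X → ℂ}
    (hK : MemKernelAlgebra μ m K) : MemKernelAlgebra μ m fun x y => conj (K y x) := by
  refine ⟨?_, ?_⟩
  · exact Complex.continuous_conj.comp_aestronglyMeasurable (hK.1.prod_swap)
  · have h : ∀ x y, weightedModulus m (fun x y => conj (K y x)) x y = weightedModulus m K y x := by
      intro x y
      rw [weightedModulus, weightedModulus, hm.symm x y, ← ofReal_norm,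
        ← ofReal_norm, RCLike.norm_conj]
    refine lt_of_le_of_lt (kernelNorm_le ?_ ?_) hK.2
    · simpa only [h] using ae_lintegral_left_le (μ := μ) (m := m) K
    · simpa only [h] using ae_lintegral_right_le (μ := μ) (m := m) K

lemma MemKernelAlgebra.const_mul {K : X → X → ℂ} (hK : MemKernelAlgebra μ m K) (c : ℂ) :
    MemKernelAlgebra μ m fun x y => c * K x y := by
  refine ⟨hK.1.const_mul c, ?_⟩
  have h : ∀ x y, weightedModulus m (fun x y => c * K x y) x y = ‖c‖ₑ * weightedModulus m K x y := by
    intro x y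
    rw [weightedModulus, weightedModulus, enorm_mul, mul_assoc]
  refine lt_of_le_of_lt (kernelNorm_le (N := ‖c‖ₑ * kernelNorm μ m K) ?_ ?_)
    (ENNReal.mul_lt_top enorm_lt_top hK.2)
  · filter_upwards [ae_lintegral_right_le (μ := μ) (m := m) K] with x hx
    simp only [h]
    rw [lintegral_const_mul' _ _ enorm_ne_top]
    gcongr
  · filter_upwards [ae_lintegral_left_le (μ := μ) (m := m) K] with x hx
    simp only [h]
    rw [lintegral_const_mul' _ _ enorm_ne_top]
    gcongr

/-- Tonelli bound behind the Schur test. -/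
lemma lintegral_lintegral_mul_le [SFinite μ] {u : X → ENNReal} {k : X → X → ENNReal} {N : ENNReal}
    (hu : Measurable u) (hk : Measurable (Function.uncurry k))
    (hN : ∀ᵐ r ∂μ, ∫⁻ q, k r q ∂μ ≤ N) :
    ∫⁻ q, ∫⁻ r, u r * k r q ∂μ ∂μ ≤ (∫⁻ r, u r ∂μ) * N := by
  rw [lintegral_lintegral_swap]
  · rw [← lintegral_mul_const _ hu]
    refine lintegral_mono_ae ?_
    filter_upwards [hN] with r hr
    have hkr : Measurable (k r) := hk.comp measurable_prodMk_left
    rw [lintegral_const_mul _ hkr]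
    gcongr
  · exact ((hu.comp measurable_snd).mul (hk.comp measurable_swap)).aemeasurable

/-- A measurable kernel that is dominated by a composition of two kernels of `𝒜_m` lies in
`𝒜_m`. -/
lemma MemKernelAlgebra.of_le_comp [SFinite μ] (hm : IsAdmissibleWeight m) {K K₁ K₂ : X → X → ℂ}
    {c : ENNReal} (hc : c ≠ ⊤) (hK : StronglyMeasurable (Function.uncurry K))
    (hK₁ : StronglyMeasurable (Function.uncurry K₁))
    (hK₂ : StronglyMeasurable (Function.uncurry K₂))
    (h₁ : MemKernelAlgebra μ m K₁) (h₂ : MemKernelAlgebra μ m K₂)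
    (hle : ∀ x y, ‖K x y‖ₑ ≤ c * ∫⁻ z, ‖K₁ x z‖ₑ * ‖K₂ z y‖ₑ ∂μ) :
    MemKernelAlgebra μ m K := by
  have hw₁ := measurable_weightedModulus hm hK₁
  have hw₂ := measurable_weightedModulus hm hK₂
  -- Since `m x y ≤ m x z * m z y`, the weight can be distributed over the two factors, and two
  -- unweighted Schur bounds remain.
  have key : ∀ x y, weightedModulus m K x y ≤
      c * ∫⁻ z, weightedModulus m K₁ x z * weightedModulus m K₂ z y ∂μ := by
    intro x y
    calc weightedModulus m K x y
        ≤ (c * ∫⁻ z, ‖K₁ x z‖ₑ * ‖K₂ z y‖ₑ ∂μ) * ENNReal.ofReal (m x y) := by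
          rw [weightedModulus]; gcongr; exact hle x y
      _ = c * ∫⁻ z, ‖K₁ x z‖ₑ * ‖K₂ z y‖ₑ * ENNReal.ofReal (m x y) ∂μ := by
          rw [mul_assoc, lintegral_mul_const' _ _ ENNReal.ofReal_ne_top]
      _ ≤ _ := by
          refine mul_le_mul_right (lintegral_mono fun z => ?_) _
          refine (mul_le_mul_right (hm.ofReal_le_mul x y z) _).trans (le_of_eq ?_)
          rw [weightedModulus, weightedModulus]; ring
  have hfin : c * (kernelNorm μ m K₁ * kernelNorm μ m K₂) < ⊤ :=
    ENNReal.mul_lt_top hc.lt_top (ENNReal.mul_lt_top h₁.2 h₂.2)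
  refine ⟨hK.aestronglyMeasurable, lt_of_le_of_lt (kernelNorm_le ?_ ?_) hfin⟩
  · filter_upwards [ae_lintegral_right_le (μ := μ) (m := m) K₁] with x hx
    refine (lintegral_mono (key x)).trans ?_
    rw [lintegral_const_mul' _ _ hc]
    gcongr
    refine (lintegral_lintegral_mul_le (hw₁.comp measurable_prodMk_left) hw₂
      (ae_lintegral_right_le K₂)).trans ?_
    gcongr
    exact hx
  · filter_upwards [ae_lintegral_left_le (μ := μ) (m := m) K₂] with y hy
    refine (lintegral_mono fun x => key x y).trans ?_
    rw [lintegral_const_mul' _ _ hc]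
    gcongr
    simp_rw [mul_comm (weightedModulus m K₁ _ _)]
    refine (lintegral_lintegral_mul_le (u := fun z => weightedModulus m K₂ z y)
      (k := fun z x => weightedModulus m K₁ x z) (hw₂.comp measurable_prodMk_right)
      (hw₁.comp measurable_swap) (ae_lintegral_left_le K₁)).trans ?_
    rw [mul_comm]
    gcongr

end KernelAlgebra

/-! ### Test spaces of tight families -/

section TightFamily

variable {X : Type*} [MeasurableSpace X] {μ : Measure X} {m : X → X → ℝ}
  {E : Type*} [NormedAddCommGroup E] [InnerProductSpace ℂ E] {𝓗 : Submodule ℂ E}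

/-- A strongly measurable family `ψ` in `𝓗` that is a continuous tight frame of `𝓗` with
bound `A`. -/
structure IsTightFamily (μ : Measure X) (𝓗 : Submodule ℂ E) (ψ : X → E) (A : ℝ) : Prop where
  stronglyMeasurable : StronglyMeasurable ψ
  mem : ∀ x, ψ x ∈ 𝓗
  pos : 0 < A
  integrable : ∀ h ∈ 𝓗, ∀ f ∈ 𝓗, Integrable (fun x => inner ℂ h (ψ x) * inner ℂ (ψ x) f) μ
  reproduce : ∀ h ∈ 𝓗, ∀ f ∈ 𝓗,
    ∫ x, inner ℂ h (ψ x) * inner ℂ (ψ x) f ∂μ = (A : ℂ) * inner ℂ h f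

/-- The `[0, ∞]`-valued version of the norm of the test space. -/
def testENorm (μ : Measure X) (ψ : X → E) (m : X → X → ℝ) (z : X) (f : E) : ENNReal :=
  ∫⁻ x, ‖(inner ℂ (ψ x) f : ℂ)‖ₑ * ENNReal.ofReal (m x z) ∂μ

lemma enorm_weight_mul (hm : IsAdmissibleWeight m) (x z : X) (a : ℂ) :
    ‖(m x z : ℂ) * a‖ₑ = ‖a‖ₑ * ENNReal.ofReal (m x z) := by
  rw [enorm_mul, mul_comm, ← ofReal_norm (m x z : ℂ), Complex.norm_real,
    Real.norm_of_nonneg (hm.pos x z).le]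

lemma stronglyMeasurable_mixedKernel {ψ ψ' : X → E} (hψ : StronglyMeasurable ψ)
    (hψ' : StronglyMeasurable ψ') :
    StronglyMeasurable (Function.uncurry (mixedKernel ψ ψ')) :=
  (hψ.comp_measurable measurable_fst).inner (hψ'.comp_measurable measurable_snd)

lemma measurable_weight_left (hm : IsAdmissibleWeight m) (z : X) : Measurable fun x => m x z :=
  hm.measurable.comp measurable_prodMk_right

lemma stronglyMeasurable_weight_mul_inner (hm : IsAdmissibleWeight m) {ψ : X → E}
    (hψ : StronglyMeasurable ψ) (z : X) (f : E) :
    StronglyMeasurable fun x => (m x z : ℂ) * inner ℂ (ψ x) f :=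
  (Complex.measurable_ofReal.comp (measurable_weight_left hm z)).stronglyMeasurable.mul
    (hψ.inner stronglyMeasurable_const)

/-- Measurability is automatic here, so all later estimates can be made in `[0, ∞]` without
integrability side conditions. -/
lemma mem_testSpace_iff (hm : IsAdmissibleWeight m) {ψ : X → E} (hψ : StronglyMeasurable ψ)
    {z : X} {f : E} : f ∈ testSpace μ 𝓗 ψ m z ↔ f ∈ 𝓗 ∧ testENorm μ ψ m z f < ⊤ := by
  have h : Integrable (fun x => (m x z : ℂ) * inner ℂ (ψ x) f) μ ↔ testENorm μ ψ m z f < ⊤ := by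
    rw [Integrable,
      and_iff_right (stronglyMeasurable_weight_mul_inner hm hψ z f).aestronglyMeasurable,
      HasFiniteIntegral, testENorm]
    simp_rw [enorm_weight_mul hm]
  rw [← h]
  rfl

lemma testNorm_eq_toReal (hm : IsAdmissibleWeight m) {ψ : X → E} (hψ : StronglyMeasurable ψ)
    (z : X) (f : E) : testNorm μ ψ m z f = (testENorm μ ψ m z f).toReal := by
  have h : ∀ x, m x z * ‖(inner ℂ (ψ x) f : ℂ)‖ = ‖(m x z : ℂ) * inner ℂ (ψ x) f‖ := by
    intro x
    rw [norm_mul, Complex.norm_real, Real.norm_of_nonneg (hm.pos x z).le]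
  simp_rw [testNorm, h]
  rw [integral_norm_eq_lintegral_enorm
    (stronglyMeasurable_weight_mul_inner hm hψ z f).aestronglyMeasurable, testENorm]
  simp_rw [enorm_weight_mul hm]

variable {ψ ψ₁ ψ₂ : X → E} {A A₁ A₂ : ℝ}

/-- The reproducing formula with absolute values inside. This is the form used for both kernel and
test norm estimates. -/
lemma IsTightFamily.enorm_inner_le (hψ : IsTightFamily μ 𝓗 ψ A) {h f : E} (hh : h ∈ 𝓗)
    (hf : f ∈ 𝓗) : ‖(inner ℂ h f : ℂ)‖ₑ ≤ ENNReal.ofReal A⁻¹ *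
      ∫⁻ x, ‖(inner ℂ h (ψ x) : ℂ)‖ₑ * ‖(inner ℂ (ψ x) f : ℂ)‖ₑ ∂μ := by
  have hA : (A : ℂ) ≠ 0 := Complex.ofReal_ne_zero.2 hψ.pos.ne'
  have h1 : (inner ℂ h f : ℂ) = (A⁻¹ : ℝ) * ∫ x, inner ℂ h (ψ x) * inner ℂ (ψ x) f ∂μ := by
    rw [hψ.reproduce h hh f hf, Complex.ofReal_inv, inv_mul_cancel_left₀ hA]
  rw [h1, enorm_mul, ← ofReal_norm ((A⁻¹ : ℝ) : ℂ), Complex.norm_real,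
    Real.norm_of_nonneg (inv_pos.2 hψ.pos).le]
  refine mul_le_mul_right ((enorm_integral_le_lintegral_enorm _).trans (le_of_eq ?_)) _
  simp_rw [enorm_mul]

/-- Mixed kernels that are linked through a tight family lie in `𝒜_m`. -/
lemma IsTightFamily.memKernelAlgebra_mixedKernel [SFinite μ] (hm : IsAdmissibleWeight m)
    (hψ : IsTightFamily μ 𝓗 ψ A) (hψ₁ : StronglyMeasurable ψ₁) (hψ₂ : StronglyMeasurable ψ₂)
    (hm₁ : ∀ x, ψ₁ x ∈ 𝓗) (hm₂ : ∀ x, ψ₂ x ∈ 𝓗)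
    (h₁ : MemKernelAlgebra μ m (mixedKernel ψ₁ ψ)) (h₂ : MemKernelAlgebra μ m (mixedKernel ψ ψ₂)) :
    MemKernelAlgebra μ m (mixedKernel ψ₁ ψ₂) :=
  MemKernelAlgebra.of_le_comp hm (c := ENNReal.ofReal A⁻¹) ENNReal.ofReal_ne_top
    (stronglyMeasurable_mixedKernel hψ₁ hψ₂)
    (stronglyMeasurable_mixedKernel hψ₁ hψ.stronglyMeasurable)
    (stronglyMeasurable_mixedKernel hψ.stronglyMeasurable hψ₂) h₁ h₂
    fun x y => hψ.enorm_inner_le (hm₁ x) (hm₂ y)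

lemma MemKernelAlgebra.mixedKernel_symm [SFinite μ] (hm : IsAdmissibleWeight m)
    (h : MemKernelAlgebra μ m (mixedKernel ψ₁ ψ₂)) :
    MemKernelAlgebra μ m (mixedKernel ψ₂ ψ₁) := by
  have := h.conj_swap hm
  simp only [mixedKernel, inner_conj_symm] at this
  exact this

/-- Change of the analysing family in the norm of the test space. -/
lemma IsTightFamily.testENorm_le [SFinite μ] (hm : IsAdmissibleWeight m)
    (hψ₁ : IsTightFamily μ 𝓗 ψ₁ A₁) (hψ₂ : StronglyMeasurable ψ₂) (hm₂ : ∀ x, ψ₂ x ∈ 𝓗)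
    (z : X) {f : E} (hf : f ∈ 𝓗) :
    testENorm μ ψ₂ m z f ≤ ENNReal.ofReal A₁⁻¹ * kernelNorm μ m (mixedKernel ψ₂ ψ₁) *
      testENorm μ ψ₁ m z f := by
  have hK := measurable_weightedModulus hm
    (stronglyMeasurable_mixedKernel hψ₂ hψ₁.stronglyMeasurable)
  set u : X → ENNReal := fun y => ‖(inner ℂ (ψ₁ y) f : ℂ)‖ₑ * ENNReal.ofReal (m y z) with hu
  have hum : Measurable u :=
    (hψ₁.stronglyMeasurable.inner stronglyMeasurable_const).enorm.mul
      (measurable_weight_left hm z).ennreal_ofReal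
  calc testENorm μ ψ₂ m z f
      ≤ ∫⁻ x, ENNReal.ofReal A₁⁻¹ *
          ∫⁻ y, u y * weightedModulus m (mixedKernel ψ₂ ψ₁) x y ∂μ ∂μ := by
        refine lintegral_mono fun x => ?_
        refine (mul_le_mul_left (hψ₁.enorm_inner_le (hm₂ x) hf) _).trans ?_
        rw [mul_assoc, ← lintegral_mul_const' _ _ ENNReal.ofReal_ne_top]
        refine mul_le_mul_right (lintegral_mono fun y => ?_) _
        -- `m x z ≤ m x y * m y z`: the first factor goes to the kernel, the second to the transform
        -- of `f`.
        refine (mul_le_mul_right (hm.ofReal_le_mul x z y) _).trans (le_of_eq ?_)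
        simp only [hu, weightedModulus, mixedKernel]
        ring
    _ ≤ ENNReal.ofReal A₁⁻¹ *
          ((∫⁻ y, u y ∂μ) * kernelNorm μ m (mixedKernel ψ₂ ψ₁)) := by
        rw [lintegral_const_mul' _ _ ENNReal.ofReal_ne_top]
        refine mul_le_mul_right ?_ _
        exact lintegral_lintegral_mul_le
          (k := fun y x => weightedModulus m (mixedKernel ψ₂ ψ₁) x y) hum
          (hK.comp measurable_swap) (ae_lintegral_left_le _)
    _ = _ := by
        rw [mul_assoc, mul_comm (lintegral μ u)]
        rfl

lemma IsTightFamily.testSpace_le [SFinite μ] (hm : IsAdmissibleWeight m)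
    (hψ₁ : IsTightFamily μ 𝓗 ψ₁ A₁) (hψ₂ : StronglyMeasurable ψ₂) (hm₂ : ∀ x, ψ₂ x ∈ 𝓗)
    (hK : MemKernelAlgebra μ m (mixedKernel ψ₂ ψ₁)) (z : X) :
    testSpace μ 𝓗 ψ₁ m z ≤ testSpace μ 𝓗 ψ₂ m z := by
  intro f hf
  rw [mem_testSpace_iff hm hψ₁.stronglyMeasurable] at hf
  rw [mem_testSpace_iff hm hψ₂]
  exact ⟨hf.1, lt_of_le_of_lt (hψ₁.testENorm_le hm hψ₂ hm₂ z hf.1)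
    (ENNReal.mul_lt_top (ENNReal.mul_lt_top ENNReal.ofReal_lt_top hK.2) hf.2)⟩

/-- Almost every atom lies in the test space, with a norm controlled by the weight. -/
lemma ae_testENorm_le (hm : IsAdmissibleWeight m) (z : X) :
    ∀ᵐ x ∂μ, testENorm μ ψ₁ m z (ψ₂ x) ≤
      kernelNorm μ m (mixedKernel ψ₁ ψ₂) * ENNReal.ofReal (m x z) := by
  filter_upwards [ae_lintegral_left_le (μ := μ) (m := m) (mixedKernel ψ₁ ψ₂)] with x hx
  refine le_trans ?_ (mul_le_mul_left hx _)
  rw [← lintegral_mul_const' _ _ ENNReal.ofReal_ne_top]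
  refine lintegral_mono fun y => ?_
  refine (mul_le_mul_right (hm.ofReal_le_mul y z x) _).trans (le_of_eq ?_)
  rw [weightedModulus, mixedKernel, mul_assoc]

end TightFamily

/-! ### Independence of the coorbit space from the analysing family -/

section CoorbitIndependence

variable {X : Type*} [MeasurableSpace X] {μ : Measure X} {m : X → X → ℝ}
  {E : Type*} [NormedAddCommGroup E] [InnerProductSpace ℂ E] {𝓗 : Submodule ℂ E}

/-- The embedding `f ↦ m(·, z) V_ψ f` of the test space into `L¹`. -/
def analysisL1 (μ : Measure X) (𝓗 : Submodule ℂ E) (ψ : X → E) (m : X → X → ℝ) (z : X) :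
    testSpace μ 𝓗 ψ m z →ₗ[ℂ] Lp ℂ 1 μ where
  toFun f := Integrable.toL1 (fun x => (m x z : ℂ) * inner ℂ (ψ x) (f : E)) f.2.2
  map_add' f g := by
    rw [← Integrable.toL1_add]
    congr 1
    ext x
    simp only [Submodule.coe_add, inner_add_right, mul_add, Pi.add_apply]
  map_smul' c f := by
    rw [RingHom.id_apply, ← Integrable.toL1_smul']
    congr 1
    ext x
    simp only [Submodule.coe_smul, inner_smul_right, Pi.smul_apply, smul_eq_mul]
    ring

lemma coeFn_analysisL1 {ψ : X → E} {z : X} (f : testSpace μ 𝓗 ψ m z) :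
    analysisL1 μ 𝓗 ψ m z f =ᵐ[μ] fun x => (m x z : ℂ) * inner ℂ (ψ x) (f : E) :=
  Integrable.coeFn_toL1 f.2.2

lemma norm_analysisL1 (hm : IsAdmissibleWeight m) {ψ : X → E} {z : X}
    (f : testSpace μ 𝓗 ψ m z) : ‖analysisL1 μ 𝓗 ψ m z f‖ = testNorm μ ψ m z (f : E) := by
  rw [L1.norm_eq_integral_norm, testNorm]
  refine integral_congr_ae ?_
  filter_upwards [coeFn_analysisL1 f] with x hx
  rw [hx, norm_mul, Complex.norm_real, Real.norm_of_nonneg (hm.pos x z).le]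

/-- A linear functional that is bounded with respect to the norm pulled back along a linear map
extends to a bounded functional on the target. -/
lemma exists_strongDual_comp_eq {V W : Type*} [AddCommGroup V] [Module ℂ V]
    [NormedAddCommGroup W] [NormedSpace ℂ W] (Φ : V →ₗ[ℂ] W) (L : V →ₗ[ℂ] ℂ) (C : ℝ)
    (hL : ∀ f, ‖L f‖ ≤ C * ‖Φ f‖) : ∃ R : W →L[ℂ] ℂ, ∀ f, R (Φ f) = L f := by
  -- The bound forces `L` to vanish on `ker Φ`, so `L` factors through `Φ`; Hahn–Banach then extends
  -- it from the range.
  have hker : L ∈ Φ.ker.dualAnnihilator := by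
    rw [Submodule.mem_dualAnnihilator]
    intro f hf
    have h := hL f
    rw [LinearMap.mem_ker.1 hf, norm_zero, mul_zero] at h
    exact norm_le_zero_iff.1 h
  rw [← LinearMap.range_dualMap_eq_dualAnnihilator_ker] at hker
  obtain ⟨S, hS⟩ := hker
  have hS' : ∀ f, S (Φ f) = L f := fun f => by rw [← hS]; rfl
  obtain ⟨R, hR, -⟩ := exists_extension_norm_eq (LinearMap.range Φ)
    ((S.comp (LinearMap.range Φ).subtype).mkContinuous C (by
      rintro ⟨_, f, rfl⟩
      simpa [hS'] using hL f))
  exact ⟨R, fun f => by simpa [hS'] using hR ⟨Φ f, f, rfl⟩⟩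

lemma voice_of_mem {P : Type*} {ψ : P → E} {S : Submodule ℂ E} (T : S →ₛₗ[starRingEnd ℂ] ℂ)
    {x : P} (h : ψ x ∈ S) : voice ψ ⟨S, T⟩ x = T ⟨ψ x, h⟩ := dif_pos h

variable {ψ ψ₁ ψ₂ : X → E} {A A₁ A₂ : ℝ}

/-- Reproducing formula for bounded functionals on the test space. -/
lemma IsTightFamily.functional_eq_integral [SFinite μ] [IsSeparable μ] (hm : IsAdmissibleWeight m)
    (hψ : IsTightFamily μ 𝓗 ψ A) (hK : MemKernelAlgebra μ m (mixedKernel ψ ψ)) {z : X}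
    (T : testSpace μ 𝓗 ψ m z →ₛₗ[starRingEnd ℂ] ℂ) (C : ℝ)
    (hT : ∀ f, ‖T f‖ ≤ C * testNorm μ ψ m z (f : E)) (f : testSpace μ 𝓗 ψ m z) :
    T f = (A : ℂ)⁻¹ * ∫ y, inner ℂ (f : E) (ψ y) * voice ψ ⟨_, T⟩ y ∂μ := by
  have hA : (A : ℂ) ≠ 0 := Complex.ofReal_ne_zero.2 hψ.pos.ne'
  have hψm := hψ.stronglyMeasurable
  set Φ := analysisL1 μ 𝓗 ψ m z with hΦ
  -- `T` is conjugate-linear, so its complex conjugate is the linear functional to extend to `L¹`.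
  obtain ⟨R, hR⟩ := exists_strongDual_comp_eq Φ
    ({ toFun := fun f => conj (T f)
       map_add' := fun a b => by rw [map_add, map_add]
       map_smul' := fun c a => by
        rw [LinearMap.map_smulₛₗ, smul_eq_mul, map_mul, Complex.conj_conj]; rfl } :
      testSpace μ 𝓗 ψ m z →ₗ[ℂ] ℂ) C (fun f => by
        rw [hΦ, norm_analysisL1 hm]
        simpa using hT f)
  replace hR : ∀ f, R (Φ f) = conj (T f) := hR
  have hfE := f.2
  rw [mem_testSpace_iff hm hψm] at hfE
  have hmem : ∀ᵐ y ∂μ, ψ y ∈ testSpace μ 𝓗 ψ m z := by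
    filter_upwards [ae_testENorm_le (μ := μ) (ψ₁ := ψ) (ψ₂ := ψ) hm z] with y hy
    rw [mem_testSpace_iff hm hψm]
    exact ⟨hψ.mem y, lt_of_le_of_lt hy (ENNReal.mul_lt_top hK.2 ENNReal.ofReal_lt_top)⟩
  classical
  set F : X → X → ℂ := fun y u => inner ℂ (ψ y) (f : E) * ((m u z : ℂ) * inner ℂ (ψ u) (ψ y))
    with hF
  have hFm : StronglyMeasurable (Function.uncurry F) := by
    refine ((hψm.comp_measurable measurable_fst).inner stronglyMeasurable_const).mul (.mul ?_ ?_)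
    · exact (Complex.measurable_ofReal.comp
        ((measurable_weight_left hm z).comp measurable_snd)).stronglyMeasurable
    · exact (hψm.comp_measurable measurable_snd).inner (hψm.comp_measurable measurable_fst)
  have hFi : Integrable (Function.uncurry F) (μ.prod μ) := by
    refine ⟨hFm.aestronglyMeasurable, ?_⟩
    rw [HasFiniteIntegral, lintegral_prod _ hFm.enorm.aemeasurable]
    -- The test norm of `ψ y` is at most the kernel norm times `m y z` for almost every `y`;
    -- integrating against `|inner (ψ y) f|` restores the test norm of `f`.
    refine lt_of_le_of_lt (b := kernelNorm μ m (mixedKernel ψ ψ) * testENorm μ ψ m z (f : E)) ?_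
      (ENNReal.mul_lt_top hK.2 hfE.2)
    rw [testENorm, ← lintegral_const_mul' _ _ hK.2.ne]
    refine lintegral_mono_ae ?_
    filter_upwards [ae_testENorm_le (μ := μ) (ψ₁ := ψ) (ψ₂ := ψ) hm z] with y hy
    simp only [Function.uncurry, hF, enorm_mul _ ((m _ z : ℂ) * _), enorm_weight_mul hm]
    rw [lintegral_const_mul' _ _ enorm_ne_top]
    refine (mul_le_mul_right hy _).trans (le_of_eq ?_)
    ring
  set g : X → Lp ℂ 1 μ := fun y => (inner ℂ (ψ y) (f : E) : ℂ) •
    if h : ψ y ∈ testSpace μ 𝓗 ψ m z then Φ ⟨ψ y, h⟩ else 0 with hg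
  have hgF : ∀ᵐ y ∂μ, g y =ᵐ[μ] F y := by
    filter_upwards [hmem] with y hy
    simp only [hg, dif_pos hy]
    filter_upwards [Lp.coeFn_smul (inner ℂ (ψ y) (f : E) : ℂ) (Φ ⟨ψ y, hy⟩),
      coeFn_analysisL1 (⟨ψ y, hy⟩ : testSpace μ 𝓗 ψ m z)] with u h1 h2
    rw [h1, Pi.smul_apply, h2, smul_eq_mul]
  obtain ⟨hgi, hgint⟩ := integrable_and_coeFn_integral_L1 hFm hFi hgF
  -- The integral over `y` can be evaluated at each `u`, where it is the reproducing formula tested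
  -- against `ψ u`. Thus `f` is a Bochner integral of atoms in the test norm.
  have hΦf : ∫ y, g y ∂μ = (A : ℂ) • Φ f := by
    refine Lp.ext (hgint.trans ?_)
    filter_upwards [Lp.coeFn_smul (A : ℂ) (Φ f), coeFn_analysisL1 f] with u h1 h2
    rw [h1, Pi.smul_apply, h2, smul_eq_mul]
    have := hψ.reproduce (ψ u) (hψ.mem u) f hfE.1
    rw [mul_left_comm, ← this, ← integral_const_mul]
    refine integral_congr_ae (Filter.Eventually.of_forall fun y => ?_)
    simp only [hF]
    ring
  have h1 : (A : ℂ) * conj (T f) =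
      ∫ y, inner ℂ (ψ y) (f : E) * conj (voice ψ ⟨_, T⟩ y) ∂μ := by
    rw [← hR, ← smul_eq_mul, ← map_smul, ← hΦf, ← R.integral_comp_comm hgi]
    refine integral_congr_ae ?_
    filter_upwards [hmem] with y hy
    simp only [hg, dif_pos hy]
    rw [voice_of_mem T hy, ← hR, map_smul, smul_eq_mul]
  have h2 : (A : ℂ) * T f = ∫ y, inner ℂ (f : E) (ψ y) * voice ψ ⟨_, T⟩ y ∂μ := by
    have := congrArg conj h1
    rw [map_mul, Complex.conj_conj, Complex.conj_ofReal, ← integral_conj] at this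
    rw [this]
    simp_rw [map_mul, Complex.conj_conj, inner_conj_symm]
  rw [← h2, inv_mul_cancel_left₀ hA]

/-- The extended transforms with respect to two tight families are related by the mixed kernel. -/
lemma IsTightFamily.ae_voice_eq [SFinite μ] [IsSeparable μ] (hm : IsAdmissibleWeight m)
    (hψ₁ : IsTightFamily μ 𝓗 ψ₁ A₁) (hm₂ : ∀ x, ψ₂ x ∈ 𝓗)
    (hK₁ : MemKernelAlgebra μ m (mixedKernel ψ₁ ψ₁))
    (hK : MemKernelAlgebra μ m (mixedKernel ψ₁ ψ₂)) {z : X}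
    (T : testSpace μ 𝓗 ψ₁ m z →ₛₗ[starRingEnd ℂ] ℂ) (C : ℝ)
    (hT : ∀ f, ‖T f‖ ≤ C * testNorm μ ψ₁ m z (f : E)) :
    ∀ᵐ x ∂μ, voice ψ₂ ⟨_, T⟩ x =
      (A₁ : ℂ)⁻¹ * kernelApply μ (mixedKernel ψ₂ ψ₁) (voice ψ₁ ⟨_, T⟩) x := by
  filter_upwards [ae_testENorm_le (μ := μ) (ψ₁ := ψ₁) (ψ₂ := ψ₂) hm z] with x hx
  have hmem : ψ₂ x ∈ testSpace μ 𝓗 ψ₁ m z := by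
    rw [mem_testSpace_iff hm hψ₁.stronglyMeasurable]
    exact ⟨hm₂ x, lt_of_le_of_lt hx (ENNReal.mul_lt_top hK.2 ENNReal.ofReal_lt_top)⟩
  rw [voice_of_mem T hmem]
  exact hψ₁.functional_eq_integral hm hK₁ T C hT ⟨ψ₂ x, hmem⟩

variable {Y : Type*} [NormedAddCommGroup Y] [NormedSpace ℂ Y]
  {ι : Y →ₗ[ℂ] (X →ₘ[μ] ℂ)}

/-- One half of the independence, with the explicit norm constant coming from the action of `A₁⁻¹
K₂₁` on `Y`. The other half follows by exchanging the families. -/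
lemma IsTightFamily.mem_coorbit [SFinite μ] [IsSeparable μ] (hm : IsAdmissibleWeight m)
    (hψ₁ : IsTightFamily μ 𝓗 ψ₁ A₁) (hψ₂ : IsTightFamily μ 𝓗 ψ₂ A₂)
    (hK₁ : MemKernelAlgebra μ m (mixedKernel ψ₁ ψ₁))
    (hK : MemKernelAlgebra μ m (mixedKernel ψ₁ ψ₂)) (hι : KernelAlgebraActs m ι) {z : X}
    {T : AntiFunctional E} (hT : T ∈ coorbit 𝓗 ψ₁ m z ι) :
    T ∈ coorbit 𝓗 ψ₂ m z ι ∧ ∀ G₁ : Y, ι G₁ =ᵐ[μ] voice ψ₁ T → ∃ G₂ : Y,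
      ι G₂ =ᵐ[μ] voice ψ₂ T ∧
      ‖G₂‖ ≤ A₁⁻¹ * (kernelNorm μ m (mixedKernel ψ₂ ψ₁)).toReal * ‖G₁‖ := by
  obtain ⟨S, T⟩ := T
  obtain ⟨hS, ⟨C, hC⟩, hG⟩ := hT
  dsimp only at hS hC hG
  subst hS
  have hK' := hK.mixedKernel_symm hm
  have hvoice : ∀ G₁ : Y, ι G₁ =ᵐ[μ] voice ψ₁ ⟨_, T⟩ → ∃ G₂ : Y,
      ι G₂ =ᵐ[μ] voice ψ₂ ⟨_, T⟩ ∧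
      ‖G₂‖ ≤ A₁⁻¹ * (kernelNorm μ m (mixedKernel ψ₂ ψ₁)).toReal * ‖G₁‖ := by
    intro G₁ hG₁
    obtain ⟨-, H, hH, hHn⟩ := hι _ hK' G₁
    refine ⟨(A₁ : ℂ)⁻¹ • H, ?_, ?_⟩
    · rw [map_smul]
      filter_upwards [AEEqFun.coeFn_smul (A₁ : ℂ)⁻¹ (ι H), hH,
        hψ₁.ae_voice_eq hm hψ₂.mem hK₁ hK T C hC] with x h1 h2 h3
      rw [h1, h3, Pi.smul_apply, h2, smul_eq_mul]
      congr 1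
      refine integral_congr_ae ?_
      filter_upwards [hG₁] with y hy
      rw [hy]
    · rw [norm_smul, norm_inv, Complex.norm_real, Real.norm_of_nonneg hψ₁.pos.le, mul_assoc]
      exact mul_le_mul_of_nonneg_left hHn (inv_pos.2 hψ₁.pos).le
  refine ⟨⟨?_, ?_, ?_⟩, hvoice⟩
  · exact le_antisymm (hψ₁.testSpace_le hm hψ₂.stronglyMeasurable hψ₂.mem hK' z)
      (hψ₂.testSpace_le hm hψ₁.stronglyMeasurable hψ₁.mem hK z)
  · set N := ENNReal.ofReal A₂⁻¹ * kernelNorm μ m (mixedKernel ψ₁ ψ₂) with hN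
    have hNfin : N < ⊤ := ENNReal.mul_lt_top ENNReal.ofReal_lt_top hK.2
    -- The given constant `C` may be negative, hence the absolute value; `N` bounds the first test
    -- norm by the second.
    refine ⟨|C| * N.toReal, fun f => (hC f).trans ?_⟩
    have hf₂ := hψ₁.testSpace_le hm hψ₂.stronglyMeasurable hψ₂.mem hK' z f.2
    rw [mem_testSpace_iff hm hψ₂.stronglyMeasurable] at hf₂
    rw [testNorm_eq_toReal hm hψ₁.stronglyMeasurable, testNorm_eq_toReal hm hψ₂.stronglyMeasurable,
      mul_assoc, ← ENNReal.toReal_mul]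
    refine mul_le_mul (le_abs_self C) (ENNReal.toReal_mono
      (ENNReal.mul_lt_top hNfin hf₂.2).ne ?_) ENNReal.toReal_nonneg (abs_nonneg C)
    exact hψ₂.testENorm_le hm hψ₁.stronglyMeasurable hψ₁.mem z hf₂.1
  · obtain ⟨G₁, hG₁⟩ := hG
    obtain ⟨G₂, hG₂, -⟩ := hvoice G₁ hG₁
    exact ⟨G₂, hG₂⟩

/-- Two tight families with mixed kernel in `𝒜_m` have the same coorbit spaces, with equivalent
norms. -/
theorem coorbit_eq_and_norm_equiv [SFinite μ] [IsSeparable μ] (hm : IsAdmissibleWeight m)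
    (hψ₁ : IsTightFamily μ 𝓗 ψ₁ A₁) (hψ₂ : IsTightFamily μ 𝓗 ψ₂ A₂)
    (hK₁ : MemKernelAlgebra μ m (mixedKernel ψ₁ ψ₁))
    (hK₂ : MemKernelAlgebra μ m (mixedKernel ψ₂ ψ₂))
    (hK : MemKernelAlgebra μ m (mixedKernel ψ₁ ψ₂)) (hinj : Function.Injective ι)
    (hι : KernelAlgebraActs m ι) (z : X) :
    coorbit 𝓗 ψ₁ m z ι = coorbit 𝓗 ψ₂ m z ι ∧
    ∃ C : ℝ, ∀ T ∈ coorbit 𝓗 ψ₁ m z ι, ∀ G₁ G₂ : Y, ι G₁ =ᵐ[μ] voice ψ₁ T →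
      ι G₂ =ᵐ[μ] voice ψ₂ T → ‖G₁‖ ≤ C * ‖G₂‖ ∧ ‖G₂‖ ≤ C * ‖G₁‖ := by
  have hK' := hK.mixedKernel_symm hm
  refine ⟨Set.Subset.antisymm (fun T hT => (hψ₁.mem_coorbit hm hψ₂ hK₁ hK hι hT).1)
    fun T hT => (hψ₂.mem_coorbit hm hψ₁ hK₂ hK' hι hT).1,
    max (A₂⁻¹ * (kernelNorm μ m (mixedKernel ψ₁ ψ₂)).toReal)
      (A₁⁻¹ * (kernelNorm μ m (mixedKernel ψ₂ ψ₁)).toReal), ?_⟩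
  intro T hT G₁ G₂ hG₁ hG₂
  obtain ⟨hT₂, h₁⟩ := hψ₁.mem_coorbit hm hψ₂ hK₁ hK hι hT
  obtain ⟨-, h₂⟩ := hψ₂.mem_coorbit hm hψ₁ hK₂ hK' hι hT₂
  obtain ⟨G₂', hG₂', hn₂⟩ := h₁ G₁ hG₁
  obtain ⟨G₁', hG₁', hn₁⟩ := h₂ G₂ hG₂
  -- An element of `Y` is determined by its function class, so the norm bounds apply to the given
  -- representatives.
  have e₂ : G₂' = G₂ := hinj (AEEqFun.ext (hG₂'.trans hG₂.symm))
  have e₁ : G₁' = G₁ := hinj (AEEqFun.ext (hG₁'.trans hG₁.symm))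
  subst e₁ e₂
  exact ⟨hn₁.trans (mul_le_mul_of_nonneg_right (le_max_left _ _) (norm_nonneg _)),
    hn₂.trans (mul_le_mul_of_nonneg_right (le_max_right _ _) (norm_nonneg _))⟩

end CoorbitIndependence

/-! ### The Fourier transform on `L²(ℝ)` -/

section Fourier

/-- Transposition rule, inherited from tempered distributions. It identifies an `L²` Fourier
transform with a concrete locally integrable function by testing. -/
lemma integral_mul_fourier_L2 (f : L2) {φ : ℝ → ℂ} (hφ : ContDiff ℝ ((⊤ : ℕ∞) : WithTop ℕ∞) φ)
    (hc : HasCompactSupport φ) : ∫ t, φ t * (𝓕 f : L2) t = ∫ t, 𝓕 φ t * f t := by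
  have h := DFunLike.congr_fun (Lp.fourier_toTemperedDistribution_eq f) (hc.toSchwartzMap hφ)
  rw [TemperedDistribution.fourier_apply, Lp.toTemperedDistribution_apply,
    Lp.toTemperedDistribution_apply] at h
  simp only [SchwartzMap.fourier_coe, smul_eq_mul] at h
  exact h.symm

lemma L2.locallyIntegrable (f : L2) : LocallyIntegrable f volume :=
  (Lp.memLp f).locallyIntegrable one_le_two

/-- On `L¹ ∩ L²` the Fourier transform of `L²` is given by the Fourier integral. -/
lemma coeFn_fourier_toLp {a : ℝ → ℂ} (h₁ : Integrable a) (h₂ : MemLp a 2) :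
    (𝓕 (h₂.toLp a) : L2) =ᵐ[volume] 𝓕 a := by
  have hcont : Continuous (𝓕 a) := VectorFourier.fourierIntegral_continuous
    Real.continuous_fourierChar (by exact continuous_inner) h₁
  refine ae_eq_of_integral_contDiff_smul_eq (L2.locallyIntegrable _) hcont.locallyIntegrable ?_
  intro g hg hgc
  have hφ : ContDiff ℝ ((⊤ : ℕ∞) : WithTop ℕ∞) fun t => (g t : ℂ) :=
    Complex.ofRealCLM.contDiff.comp hg
  have hφc : HasCompactSupport fun t => (g t : ℂ) :=
    hgc.comp_left (g := ((↑) : ℝ → ℂ)) Complex.ofReal_zero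
  have hφi : Integrable fun t => (g t : ℂ) := hφ.continuous.integrable_of_hasCompactSupport hφc
  have h := integral_mul_fourier_L2 (h₂.toLp a) hφ hφc
  simp only [Complex.real_smul]
  rw [h]
  have hflip := VectorFourier.integral_fourierIntegral_smul_eq_flip (μ := volume) (ν := volume)
    (L := innerₗ ℝ) Real.continuous_fourierChar (by exact continuous_inner) hφi h₁
  rw [flip_innerₗ] at hflip
  refine Eq.trans (integral_congr_ae ?_) hflip
  filter_upwards [h₂.coeFn_toLp] with t ht
  rw [ht, smul_eq_mul]
  rfl

lemma coeFn_translate (ξ : ℝ) (f : L2) : translate ξ f =ᵐ[volume] fun t => f (t - ξ) :=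
  Lp.coeFn_compMeasurePreserving f _

lemma contDiff_fourierChar_neg_mul (ξ : ℝ) :
    ContDiff ℝ ((⊤ : ℕ∞) : WithTop ℕ∞) fun t : ℝ => (𝐞 (-(t * ξ)) : ℂ) := by
  simp only [Real.fourierChar_apply]
  have h : ContDiff ℝ ((⊤ : ℕ∞) : WithTop ℕ∞) fun t : ℝ => 2 * Real.pi * -(t * ξ) := by fun_prop
  exact ((Complex.ofRealCLM.contDiff.comp h).mul contDiff_const).cexp

/-- The Fourier transform turns translations into modulations. -/
lemma coeFn_fourier_translate (ξ : ℝ) (f : L2) :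
    (𝓕 (translate ξ f) : L2) =ᵐ[volume] fun t => (𝐞 (-(t * ξ)) : ℂ) * (𝓕 f : L2) t := by
  have hmod : MemLp (fun t => (𝐞 (-(t * ξ)) : ℂ) * (𝓕 f : L2) t) 2 :=
    (Lp.memLp (𝓕 f : L2)).congr_norm
      ((contDiff_fourierChar_neg_mul ξ).continuous.aestronglyMeasurable.mul
        (Lp.aestronglyMeasurable _))
      (Filter.Eventually.of_forall fun t => by rw [norm_mul, Circle.norm_coe, one_mul])
  refine ae_eq_of_integral_contDiff_smul_eq (L2.locallyIntegrable _)
    (hmod.locallyIntegrable one_le_two) ?_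
  intro g hg hgc
  have hφ : ContDiff ℝ ((⊤ : ℕ∞) : WithTop ℕ∞) fun t => (g t : ℂ) :=
    Complex.ofRealCLM.contDiff.comp hg
  have hφc : HasCompactSupport fun t => (g t : ℂ) :=
    hgc.comp_left (g := ((↑) : ℝ → ℂ)) Complex.ofReal_zero
  have h1 := integral_mul_fourier_L2 (translate ξ f) hφ hφc
  have h2 := integral_mul_fourier_L2 f (φ := fun t => (𝐞 (-(t * ξ)) : ℂ) * (g t : ℂ))
    ((contDiff_fourierChar_neg_mul ξ).mul hφ) hφc.mul_left
  simp only [Complex.real_smul]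
  rw [h1]
  have h3 : ∀ t, (g t : ℂ) * ((𝐞 (-(t * ξ)) : ℂ) * (𝓕 f : L2) t) =
      (𝐞 (-(t * ξ)) : ℂ) * (g t : ℂ) * (𝓕 f : L2) t := fun t => by ring
  simp_rw [h3]
  rw [h2]
  -- Modulating the test function shifts its Fourier transform; translation invariance then moves
  -- the shift onto `f`.
  have h4 : ∀ t, 𝓕 (fun t => (𝐞 (-(t * ξ)) : ℂ) * (g t : ℂ)) t =
      𝓕 (fun t => (g t : ℂ)) (t + ξ) := by
    intro t
    rw [Real.fourier_real_eq, Real.fourier_real_eq]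
    refine integral_congr_ae (Filter.Eventually.of_forall fun s => ?_)
    simp only [Circle.smul_def, smul_eq_mul]
    rw [← mul_assoc, ← Circle.coe_mul, ← AddChar.map_add_eq_mul]
    congr 4
    ring
  simp_rw [h4]
  rw [integral_congr_ae (g := fun t => 𝓕 (fun t => (g t : ℂ)) t * f (t - ξ))
    ((coeFn_translate ξ f).mono fun t ht => by simp only [ht]),
    ← integral_sub_right_eq_self (fun t => 𝓕 (fun t => (g t : ℂ)) (t + ξ) * f t) ξ]
  simp only [sub_add_cancel]

end Fourier

/-! ### Change of variables along a warping function -/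

section Warping

variable {D : Set ℝ} {F : ℝ → ℝ}

lemma IsWarpingFunction.isOpen (hF : IsWarpingFunction D F) : IsOpen D := by
  rcases hF.domain with rfl | rfl
  exacts [isOpen_univ, isOpen_Ioi]

lemma IsWarpingFunction.measurableSet (hF : IsWarpingFunction D F) : MeasurableSet D :=
  hF.isOpen.measurableSet

lemma IsWarpingFunction.hasDerivWithinAt (hF : IsWarpingFunction D F) {t : ℝ} (ht : t ∈ D) :
    HasDerivWithinAt F (deriv F t) D t :=
  ((hF.contDiffOn.differentiableOn one_ne_zero).differentiableAt
    (hF.isOpen.mem_nhds ht)).hasDerivAt.hasDerivWithinAt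

lemma IsWarpingFunction.lintegral_deriv_mul_comp (hF : IsWarpingFunction D F) (g : ℝ → ENNReal) :
    ∫⁻ t in D, ENNReal.ofReal (deriv F t) * g (F t) = ∫⁻ s, g s := by
  have h := lintegral_image_eq_lintegral_abs_deriv_mul hF.measurableSet
    (fun t ht => hF.hasDerivWithinAt ht) hF.bijOn.injOn g
  rw [hF.bijOn.image_eq, setLIntegral_univ] at h
  rw [h]
  refine setLIntegral_congr_fun hF.measurableSet fun t ht => ?_
  simp only [abs_of_pos (hF.deriv_pos t ht)]

lemma IsWarpingFunction.integral_deriv_mul_comp (hF : IsWarpingFunction D F) (g : ℝ → ℂ) :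
    ∫ t in D, ((deriv F t : ℝ) : ℂ) * g (F t) = ∫ s, g s := by
  have h := integral_image_eq_integral_abs_deriv_smul hF.measurableSet
    (fun t ht => hF.hasDerivWithinAt ht) hF.bijOn.injOn g
  rw [hF.bijOn.image_eq, setIntegral_univ] at h
  rw [h]
  refine setIntegral_congr_fun hF.measurableSet fun t ht => ?_
  simp only [abs_of_pos (hF.deriv_pos t ht), Complex.real_smul]

lemma IsWarpingFunction.warpWeight_apply (hF : IsWarpingFunction D F) {t : ℝ} (ht : t ∈ D) :
    warpWeight D F (F t) = (deriv F t)⁻¹ := by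
  rw [warpWeight, hF.bijOn.invOn_invFunOn.1 ht]

lemma IsWarpingFunction.warpWeight_pos (hF : IsWarpingFunction D F) (s : ℝ) :
    0 < warpWeight D F s := by
  obtain ⟨t, ht, rfl⟩ := hF.bijOn.surjOn (Set.mem_univ s)
  rw [hF.warpWeight_apply ht]
  exact inv_pos.2 (hF.deriv_pos t ht)

lemma IsWarpingFunction.lintegral_comp (hF : IsWarpingFunction D F) (g : ℝ → ENNReal) :
    ∫⁻ t in D, g (F t) = ∫⁻ s, ENNReal.ofReal (warpWeight D F s) * g s := by
  rw [← hF.lintegral_deriv_mul_comp]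
  refine setLIntegral_congr_fun hF.measurableSet fun t ht => ?_
  have hpos := hF.deriv_pos t ht
  rw [← mul_assoc, hF.warpWeight_apply ht, ← ENNReal.ofReal_mul hpos.le,
    mul_inv_cancel₀ hpos.ne', ENNReal.ofReal_one, one_mul]

/-- `F` pulls null sets back to null sets, because the pushforward of Lebesgue measure on `D` has
density `w`. -/
lemma IsWarpingFunction.ae_comp (hF : IsWarpingFunction D F) {p : ℝ → Prop} (hp : ∀ᵐ s, p s) :
    ∀ᵐ t, t ∈ D → p (F t) := by
  rw [← ae_restrict_iff' hF.measurableSet]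
  set N := toMeasurable volume {s | ¬ p s} with hN
  have hN0 : volume N = 0 := by rw [hN, measure_toMeasurable]; exact hp
  have hNm : MeasurableSet N := measurableSet_toMeasurable _ _
  have h0 : ∫⁻ t in D, N.indicator 1 (F t) = 0 := by
    rw [hF.lintegral_comp]
    refine lintegral_eq_zero_of_ae_eq_zero ?_
    filter_upwards [compl_mem_ae_iff.2 hN0] with s hs
    rw [Set.indicator_of_notMem hs, mul_zero, Pi.zero_apply]
  have hFm : AEMeasurable F (volume.restrict D) :=
    hF.contDiffOn.continuousOn.aemeasurable hF.measurableSet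
  have hind : AEMeasurable (fun t => N.indicator (1 : ℝ → ENNReal) (F t)) (volume.restrict D) :=
    (measurable_one.indicator hNm).comp_aemeasurable hFm
  rw [lintegral_eq_zero_iff' hind] at h0
  filter_upwards [h0] with t ht
  by_contra hpt
  have : F t ∈ N := subset_toMeasurable _ _ hpt
  simp [this] at ht

/-- `F` is arbitrary outside `D`, so global measurability is only available after cutting off. -/
lemma IsWarpingFunction.measurable_indicator (hF : IsWarpingFunction D F) :
    Measurable (D.indicator F) := by
  classical
  rw [← Set.piecewise_eq_indicator]
  exact hF.contDiffOn.continuousOn.measurable_piecewise continuousOn_const hF.measurableSet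

lemma IsWarpingFunction.sigmaFinite_comap (hF : IsWarpingFunction D F) :
    SigmaFinite (Measure.comap ((↑) : D → ℝ) volume) := by
  refine SigmaFinite.of_map _ measurable_subtype_coe.aemeasurable ?_
  rw [(MeasurableEmbedding.subtype_coe hF.measurableSet).map_comap]
  infer_instance

end Warping

/-! ### Windows and atoms -/

section Atoms

lemma memLp_two_iff_lintegral {X : Type*} [MeasurableSpace X] {μ : Measure X} {f : X → ℂ}
    (hf : AEStronglyMeasurable f μ) : MemLp f 2 μ ↔ ∫⁻ x, ‖f x‖ₑ ^ 2 ∂μ < ⊤ := by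
  rw [MemLp, and_iff_right hf, eLpNorm_lt_top_iff_lintegral_rpow_enorm_lt_top two_ne_zero
    ENNReal.ofNat_ne_top]
  simp

lemma enorm_toLp_sq {X : Type*} [MeasurableSpace X] {μ : Measure X} {f : X → ℂ}
    (hf : MemLp f 2 μ) : ‖hf.toLp f‖ₑ ^ 2 = ∫⁻ x, ‖f x‖ₑ ^ 2 ∂μ := by
  rw [Lp.enorm_toLp, eLpNorm_eq_lintegral_rpow_enorm_toReal two_ne_zero ENNReal.ofNat_ne_top,
    ← ENNReal.rpow_natCast, ← ENNReal.rpow_mul]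
  simp

variable {D : Set ℝ} {F : ℝ → ℝ} {θ θ' θ₁ θ₂ : ℝ → ℂ}

lemma IsPrototype.congr_ae (hθ : IsPrototype D F θ) (h : θ =ᵐ[volume] θ') :
    IsPrototype D F θ' :=
  ⟨hθ.1.ae_eq (h.mono fun t ht => by simp only [ht]), hθ.2.ae_eq h⟩

lemma warpedWindow_congr_ae (hF : IsWarpingFunction D F) (h : θ =ᵐ[volume] θ') (x : ℝ) :
    warpedWindow D F θ x =ᵐ[volume] warpedWindow D F θ' x := by
  have h' : ∀ᵐ s, θ (s - F x) = θ' (s - F x) :=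
    (measurePreserving_sub_right volume (F x)).quasiMeasurePreserving.ae h
  filter_upwards [hF.ae_comp h'] with t ht
  by_cases htD : t ∈ D
  · simp only [warpedWindow, Set.indicator_of_mem htD, ht htD]
  · simp only [warpedWindow, Set.indicator_of_notMem htD]

/-- Equality holds for every `p`, so a prototype may be replaced by a strongly measurable
representative. -/
lemma warpedAtom_congr_ae (hF : IsWarpingFunction D F) (h : θ =ᵐ[volume] θ') :
    warpedAtom D F θ = warpedAtom D F θ' := by
  ext1 p
  have hw := warpedWindow_congr_ae hF h p.1
  by_cases hL : MemLp (warpedWindow D F θ p.1) 2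
  · have hL' := hL.ae_eq hw
    rw [warpedAtom, warpedAtom, dif_pos hL, dif_pos hL', (MemLp.toLp_eq_toLp_iff hL hL').2 hw]
  · have hL' : ¬ MemLp (warpedWindow D F θ' p.1) 2 := fun h' => hL (h'.ae_eq hw.symm)
    rw [warpedAtom, warpedAtom, dif_neg hL, dif_neg hL']

lemma stronglyMeasurable_warpedWindow (hF : IsWarpingFunction D F) (hθ : StronglyMeasurable θ) :
    StronglyMeasurable fun q : D × ℝ => warpedWindow D F θ q.1 q.2 := by
  have h : (fun q : D × ℝ => warpedWindow D F θ q.1 q.2) =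
      (Prod.snd ⁻¹' D).indicator fun q : D × ℝ => (Real.sqrt (deriv F q.1) : ℂ) *
        θ (D.indicator F q.2 - D.indicator F q.1) := by
    ext ⟨x, t⟩
    by_cases ht : t ∈ D
    · simp [warpedWindow, ht]
    · simp [warpedWindow, ht]
  rw [h]
  have hx : Measurable fun q : D × ℝ => (q.1 : ℝ) := measurable_subtype_coe.comp measurable_fst
  refine StronglyMeasurable.indicator (.mul ?_ ?_) (measurable_snd hF.measurableSet)
  · exact (Complex.measurable_ofReal.comp
      ((measurable_deriv F).comp hx).sqrt).stronglyMeasurable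
  · exact hθ.comp_measurable ((hF.measurable_indicator.comp measurable_snd).sub
      (hF.measurable_indicator.comp hx))

lemma enorm_warpedWindow_sq (hF : IsWarpingFunction D F) {x t : ℝ} (hx : x ∈ D) (ht : t ∈ D) :
    ‖warpedWindow D F θ x t‖ₑ ^ 2 = ENNReal.ofReal (deriv F x) * ‖θ (F t - F x)‖ₑ ^ 2 := by
  rw [warpedWindow, Set.indicator_of_mem ht, enorm_mul, mul_pow, ← ofReal_norm ((_ : ℝ) : ℂ),
    Complex.norm_real, Real.norm_of_nonneg (Real.sqrt_nonneg _),
    ← ENNReal.ofReal_pow (Real.sqrt_nonneg _), Real.sq_sqrt (hF.deriv_pos x hx).le]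

lemma warpedWindow_of_notMem {x t : ℝ} (ht : t ∉ D) : warpedWindow D F θ x t = 0 :=
  Set.indicator_of_notMem ht _

/-- The windows of a prototype are square integrable. -/
lemma IsPrototype.memLp_warpedWindow (hF : IsWarpingFunction D F) (hθ : IsPrototype D F θ)
    (x : D) : MemLp (warpedWindow D F θ x) 2 := by
  obtain ⟨θ', hθ', hae⟩ := hθ.2.aestronglyMeasurable
  have hP := hθ.congr_ae hae
  refine MemLp.ae_eq (warpedWindow_congr_ae hF hae x).symm ?_
  have hm : StronglyMeasurable (warpedWindow D F θ' x) :=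
    (stronglyMeasurable_warpedWindow hF hθ').comp_measurable
      (g := fun t : ℝ => (x, t)) measurable_prodMk_left
  rw [memLp_two_iff_lintegral hm.aestronglyMeasurable]
  obtain ⟨v, ⟨hv, -⟩, C, hC⟩ := hF.moderate
  have hw := (memLp_two_iff_lintegral hP.1.aestronglyMeasurable).1 hP.1
  have hsq : ∀ s, ‖(Real.sqrt (warpWeight D F s) : ℂ) * θ' s‖ₑ ^ 2 =
      ENNReal.ofReal (warpWeight D F s) * ‖θ' s‖ₑ ^ 2 := by
    intro s
    rw [enorm_mul, mul_pow, ← ofReal_norm ((_ : ℝ) : ℂ), Complex.norm_real,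
      Real.norm_of_nonneg (Real.sqrt_nonneg _), ← ENNReal.ofReal_pow (Real.sqrt_nonneg _),
      Real.sq_sqrt (hF.warpWeight_pos s).le]
  simp_rw [hsq] at hw
  calc ∫⁻ t, ‖warpedWindow D F θ' x t‖ₑ ^ 2
      = ∫⁻ t in D, ‖warpedWindow D F θ' x t‖ₑ ^ 2 := by
        rw [← lintegral_indicator hF.measurableSet]
        refine lintegral_congr fun t => ?_
        by_cases ht : t ∈ D
        · rw [Set.indicator_of_mem ht]
        · rw [Set.indicator_of_notMem ht, warpedWindow_of_notMem ht, enorm_zero,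
            zero_pow two_ne_zero]
    _ = ∫⁻ t in D, ENNReal.ofReal (deriv F x) * ‖θ' (F t - F x)‖ₑ ^ 2 :=
        setLIntegral_congr_fun hF.measurableSet fun t ht => enorm_warpedWindow_sq hF x.2 ht
    _ = ENNReal.ofReal (deriv F x) *
          ∫⁻ s, ENNReal.ofReal (warpWeight D F s) * ‖θ' (s - F x)‖ₑ ^ 2 := by
        rw [lintegral_const_mul' _ _ ENNReal.ofReal_ne_top,
          hF.lintegral_comp fun s => ‖θ' (s - F x)‖ₑ ^ 2]
    _ = ENNReal.ofReal (deriv F x) *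
          ∫⁻ s, ENNReal.ofReal (warpWeight D F (F x + s)) * ‖θ' s‖ₑ ^ 2 := by
        rw [← lintegral_sub_right_eq_self
          (fun s => ENNReal.ofReal (warpWeight D F (F x + s)) * ‖θ' s‖ₑ ^ 2) (F x)]
        simp only [add_sub_cancel]
    -- Moderateness: `w (F x + s) ≤ C * v (F x) * w s`, which leaves the weighted norm of the
    -- prototype.
    _ ≤ ENNReal.ofReal (deriv F x) * (ENNReal.ofReal (C * v (F x)) *
          ∫⁻ s, ENNReal.ofReal (warpWeight D F s) * ‖θ' s‖ₑ ^ 2) := by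
        refine mul_le_mul_right ?_ _
        rw [← lintegral_const_mul' _ _ ENNReal.ofReal_ne_top]
        refine lintegral_mono fun s => ?_
        rw [← mul_assoc, ← ENNReal.ofReal_mul' (hF.warpWeight_pos s).le]
        exact mul_le_mul_left (ENNReal.ofReal_le_ofReal (hC _ _)) _
    _ < ⊤ := ENNReal.mul_lt_top ENNReal.ofReal_lt_top (ENNReal.mul_lt_top ENNReal.ofReal_lt_top hw)

/-- The Fourier transform of the atom `g_{x,ξ}`. -/
def modulatedWindow (D : Set ℝ) (F : ℝ → ℝ) (θ : ℝ → ℂ) (p : D × ℝ) (t : ℝ) : ℂ :=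
  (𝐞 (-(t * p.2)) : ℂ) * warpedWindow D F θ p.1 t

lemma IsPrototype.coeFn_fourier_warpedAtom (hF : IsWarpingFunction D F) (hθ : IsPrototype D F θ)
    (p : D × ℝ) : (𝓕 (warpedAtom D F θ p) : L2) =ᵐ[volume] modulatedWindow D F θ p := by
  have hL := hθ.memLp_warpedWindow hF p.1
  rw [warpedAtom, dif_pos hL]
  have h : (𝓕 (𝓕⁻ (hL.toLp _)) : L2) = hL.toLp _ :=
    (Lp.fourierTransformₗᵢ ℝ ℂ).apply_symm_apply _
  filter_upwards [coeFn_fourier_translate p.2 (𝓕⁻ (hL.toLp _)), hL.coeFn_toLp] with t h1 h2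
  rw [h1, h, h2, modulatedWindow]

lemma IsPrototype.warpedAtom_mem (hF : IsWarpingFunction D F) (hθ : IsPrototype D F θ)
    (p : D × ℝ) : warpedAtom D F θ p ∈ bandSpace D := by
  change ∀ᵐ t, t ∉ D → (𝓕 (warpedAtom D F θ p) : L2) t = 0
  filter_upwards [hθ.coeFn_fourier_warpedAtom hF p] with t ht htD
  rw [ht, modulatedWindow, warpedWindow_of_notMem htD, mul_zero]

/-- On the Fourier side the atoms are explicit, jointly measurable functions; the inverse Fourier
isometry carries the measurability back. -/
lemma IsPrototype.stronglyMeasurable_warpedAtom (hF : IsWarpingFunction D F)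
    (hθ : IsPrototype D F θ) : StronglyMeasurable (warpedAtom D F θ) := by
  obtain ⟨θ', hθ', hae⟩ := hθ.2.aestronglyMeasurable
  have hP := hθ.congr_ae hae
  rw [warpedAtom_congr_ae hF hae]
  have : Fact ((2 : ENNReal) ≠ ⊤) := ⟨ENNReal.ofNat_ne_top⟩
  have hm : StronglyMeasurable (Function.uncurry (modulatedWindow D F θ')) := by
    refine StronglyMeasurable.mul ?_ ?_
    · refine (Continuous.stronglyMeasurable ?_)
      exact continuous_subtype_val.comp (Real.continuous_fourierChar.comp (by fun_prop))
    · exact (stronglyMeasurable_warpedWindow hF hθ').comp_measurable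
        (measurable_fst.fst.prodMk measurable_snd)
  have hL : ∀ p, MemLp (modulatedWindow D F θ' p) 2 := fun p =>
    (Lp.memLp (𝓕 (warpedAtom D F θ' p) : L2)).ae_eq (hP.coeFn_fourier_warpedAtom hF p)
  have h := stronglyMeasurable_toLp hm hL
  have h' : warpedAtom D F θ' =
      fun p => (Lp.fourierTransformₗᵢ ℝ ℂ).symm ((hL p).toLp (modulatedWindow D F θ' p)) := by
    ext1 p
    rw [LinearIsometryEquiv.eq_symm_apply]
    exact Lp.ext ((hP.coeFn_fourier_warpedAtom hF p).trans (hL p).coeFn_toLp.symm)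
  rw [h']
  exact (Lp.fourierTransformₗᵢ ℝ ℂ).symm.continuous.comp_stronglyMeasurable h

/-- Coefficients with respect to the atoms are Fourier integrals. -/
lemma IsPrototype.inner_warpedAtom (hF : IsWarpingFunction D F) (hθ : IsPrototype D F θ)
    (h : L2) (p : D × ℝ) : inner ℂ h (warpedAtom D F θ p) =
      𝓕 (fun t => warpedWindow D F θ p.1 t * conj ((𝓕 h : L2) t)) p.2 := by
  rw [← Lp.inner_fourier_eq, L2.inner_def, Real.fourier_real_eq]
  refine integral_congr_ae ?_
  filter_upwards [hθ.coeFn_fourier_warpedAtom hF p] with t ht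
  rw [ht, RCLike.inner_apply, modulatedWindow, Circle.smul_def, smul_eq_mul, mul_assoc]

end Atoms

/-! ### Orthogonality relations for warped systems -/

section Orthogonality

variable {D : Set ℝ} {F : ℝ → ℝ} {θ θ₁ θ₂ : ℝ → ℂ}

/-- The integration runs over the window position `x`, for which `F'(x)` is the Jacobian;
translation invariance removes `F t`. -/
lemma lintegral_warpedWindow_sq (hF : IsWarpingFunction D F) (θ : ℝ → ℂ) {t : ℝ} (ht : t ∈ D) :
    ∫⁻ x : D, ‖warpedWindow D F θ x t‖ₑ ^ 2 ∂(Measure.comap ((↑) : D → ℝ) volume) =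
      ∫⁻ s, ‖θ s‖ₑ ^ 2 := by
  rw [lintegral_subtype_comap hF.measurableSet fun x => ‖warpedWindow D F θ x t‖ₑ ^ 2,
    setLIntegral_congr_fun hF.measurableSet fun x hx => enorm_warpedWindow_sq hF hx ht,
    hF.lintegral_deriv_mul_comp fun s => ‖θ (F t - s)‖ₑ ^ 2]
  exact lintegral_sub_left_eq_self (fun s => ‖θ s‖ₑ ^ 2) (F t)

lemma integral_warpedWindow_mul_conj (hF : IsWarpingFunction D F) (θ₁ θ₂ : ℝ → ℂ) {t : ℝ}
    (ht : t ∈ D) :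
    ∫ x : D, warpedWindow D F θ₁ x t * conj (warpedWindow D F θ₂ x t)
      ∂(Measure.comap ((↑) : D → ℝ) volume) = l2Inner θ₁ θ₂ := by
  rw [integral_subtype_comap hF.measurableSet
    fun x => warpedWindow D F θ₁ x t * conj (warpedWindow D F θ₂ x t)]
  have h : ∀ x ∈ D, warpedWindow D F θ₁ x t * conj (warpedWindow D F θ₂ x t) =
      ((deriv F x : ℝ) : ℂ) * (θ₁ (F t - F x) * conj (θ₂ (F t - F x))) := by
    intro x hx
    simp only [warpedWindow, Set.indicator_of_mem ht, map_mul, Complex.conj_ofReal]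
    rw [mul_mul_mul_comm, ← Complex.ofReal_mul, Real.mul_self_sqrt (hF.deriv_pos x hx).le]
  rw [setIntegral_congr_fun hF.measurableSet h,
    hF.integral_deriv_mul_comp fun s => θ₁ (F t - s) * conj (θ₂ (F t - s))]
  exact integral_sub_left_eq_self (fun s => θ₁ s * conj (θ₂ s)) volume (F t)

/-- The product `g_x · conj (𝓕 h)`, whose Fourier transform is the coefficient function of `h`. -/
def windowedSpectrum (D : Set ℝ) (F : ℝ → ℝ) (θ : ℝ → ℂ) (h : L2) (x t : ℝ) : ℂ :=
  warpedWindow D F θ x t * conj ((𝓕 h : L2) t)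

lemma stronglyMeasurable_windowedSpectrum (hF : IsWarpingFunction D F)
    (hθ : StronglyMeasurable θ) (h : L2) :
    StronglyMeasurable fun q : D × ℝ => windowedSpectrum D F θ h q.1 q.2 :=
  (stronglyMeasurable_warpedWindow hF hθ).mul (Complex.continuous_conj.comp_stronglyMeasurable
    ((Lp.stronglyMeasurable (𝓕 h : L2)).comp_measurable measurable_snd))

lemma IsPrototype.integrable_windowedSpectrum (hF : IsWarpingFunction D F)
    (hθ : IsPrototype D F θ) (h : L2) (x : D) : Integrable (windowedSpectrum D F θ h x) :=
  (hθ.memLp_warpedWindow hF x).integrable_mul (Lp.memLp (𝓕 h : L2)).star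

/-- Tonelli with `x` innermost: the window contributes at most `‖θ‖²` for each `t`, leaving `‖θ‖²
‖h‖²`. -/
lemma IsPrototype.memLp_windowedSpectrum (hF : IsWarpingFunction D F)
    (hθ : IsPrototype D F θ) (hθm : StronglyMeasurable θ) (h : L2) :
    MemLp (fun q : D × ℝ => windowedSpectrum D F θ h q.1 q.2) 2 (phaseMeasure D) := by
  have := hF.sigmaFinite_comap
  have hm := stronglyMeasurable_windowedSpectrum hF hθm h
  rw [memLp_two_iff_lintegral hm.aestronglyMeasurable, phaseMeasure,
    lintegral_prod_symm' _ (hm.enorm.pow_const 2)]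
  have hθ2 := (memLp_two_iff_lintegral hθ.2.aestronglyMeasurable).1 hθ.2
  have hh := (memLp_two_iff_lintegral (Lp.aestronglyMeasurable (𝓕 h : L2))).1 (Lp.memLp _)
  refine lt_of_le_of_lt (lintegral_mono (g := fun t =>
    (∫⁻ s, ‖θ s‖ₑ ^ 2) * ‖(𝓕 h : L2) t‖ₑ ^ 2) fun t => ?_) ?_
  · simp only [windowedSpectrum, enorm_mul, mul_pow]
    rw [lintegral_mul_const' _ _ (by simp)]
    refine mul_le_mul' ?_ (by rw [← ofReal_norm, RCLike.norm_conj, ofReal_norm])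
    by_cases ht : t ∈ D
    · exact (lintegral_warpedWindow_sq hF θ ht).le
    · simp [warpedWindow_of_notMem ht]
  · rw [lintegral_const_mul' _ _ hθ2.ne]
    exact ENNReal.mul_lt_top hθ2 hh

/-- A product of two `L²` functions is in general only in `L¹`, so Plancherel in `ξ` is available
only for almost every `x`. -/
lemma IsPrototype.ae_memLp_windowedSpectrum (hF : IsWarpingFunction D F)
    (hθ : IsPrototype D F θ) (hθm : StronglyMeasurable θ) (h : L2) :
    ∀ᵐ x : D ∂(Measure.comap ((↑) : D → ℝ) volume), MemLp (windowedSpectrum D F θ h x) 2 := by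
  have := hF.sigmaFinite_comap
  have hm := stronglyMeasurable_windowedSpectrum hF hθm h
  have hL := hθ.memLp_windowedSpectrum hF hθm h
  rw [memLp_two_iff_lintegral hm.aestronglyMeasurable, phaseMeasure,
    lintegral_prod _ (hm.enorm.pow_const 2).aemeasurable] at hL
  have hmL : Measurable fun x : D => ∫⁻ t, ‖windowedSpectrum D F θ h x t‖ₑ ^ 2 :=
    Measurable.lintegral_prod_right' (f := fun q : D × ℝ => ‖windowedSpectrum D F θ h q.1 q.2‖ₑ ^ 2)
      (hm.enorm.pow_const 2)
  filter_upwards [ae_lt_top hmL hL.ne] with x hx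
  have hmx : StronglyMeasurable (windowedSpectrum D F θ h x) :=
    hm.comp_measurable (g := fun t : ℝ => (x, t)) measurable_prodMk_left
  exact (memLp_two_iff_lintegral hmx.aestronglyMeasurable).2 hx

lemma IsPrototype.coeFn_fourier_windowedSpectrum (hF : IsWarpingFunction D F)
    (hθ : IsPrototype D F θ) (h : L2) (x : D) (hL : MemLp (windowedSpectrum D F θ h x) 2) :
    (𝓕 (hL.toLp _) : L2) =ᵐ[volume] fun ξ => inner ℂ h (warpedAtom D F θ (x, ξ)) := by
  filter_upwards [coeFn_fourier_toLp (hθ.integrable_windowedSpectrum hF h x) hL] with ξ hξ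
  rw [hξ, hθ.inner_warpedAtom hF]
  rfl

lemma IsPrototype.memLp_inner_warpedAtom (hF : IsWarpingFunction D F)
    (hθ : IsPrototype D F θ) (hθm : StronglyMeasurable θ) (h : L2) :
    MemLp (fun p => inner ℂ h (warpedAtom D F θ p)) 2 (phaseMeasure D) := by
  have := hF.sigmaFinite_comap
  have hm : StronglyMeasurable fun p => (inner ℂ h (warpedAtom D F θ p) : ℂ) :=
    stronglyMeasurable_const.inner (hθ.stronglyMeasurable_warpedAtom hF)
  have hmB := stronglyMeasurable_windowedSpectrum hF hθm h
  have hL := hθ.memLp_windowedSpectrum hF hθm h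
  rw [memLp_two_iff_lintegral hmB.aestronglyMeasurable, phaseMeasure,
    lintegral_prod _ (hmB.enorm.pow_const 2).aemeasurable] at hL
  rw [memLp_two_iff_lintegral hm.aestronglyMeasurable, phaseMeasure,
    lintegral_prod _ (hm.enorm.pow_const 2).aemeasurable]
  refine lt_of_le_of_lt (lintegral_mono_ae ?_) hL
  filter_upwards [hθ.ae_memLp_windowedSpectrum hF hθm h] with x hx
  have hV := (Lp.memLp (𝓕 (hx.toLp _) : L2)).ae_eq (hθ.coeFn_fourier_windowedSpectrum hF h x hx)
  have hVe : hV.toLp _ = (𝓕 (hx.toLp _) : L2) :=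
    Lp.ext (hV.coeFn_toLp.trans (hθ.coeFn_fourier_windowedSpectrum hF h x hx).symm)
  rw [← enorm_toLp_sq hV, ← enorm_toLp_sq hx, hVe, ← ofReal_norm, Lp.norm_fourier_eq, ofReal_norm]

lemma integral_inner_mul_inner_warpedAtom (hF : IsWarpingFunction D F)
    (hθ₁ : IsPrototype D F θ₁) (hθ₂ : IsPrototype D F θ₂) (h f : L2) (x : D)
    (h₁ : MemLp (windowedSpectrum D F θ₁ h x) 2) (h₂ : MemLp (windowedSpectrum D F θ₂ f x) 2) :
    ∫ ξ, inner ℂ h (warpedAtom D F θ₁ (x, ξ)) * inner ℂ (warpedAtom D F θ₂ (x, ξ)) f =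
      ∫ t, windowedSpectrum D F θ₁ h x t * conj (windowedSpectrum D F θ₂ f x t) := by
  have e := Lp.inner_fourier_eq (h₂.toLp _) (h₁.toLp _)
  rw [L2.inner_def, L2.inner_def] at e
  refine Eq.trans (integral_congr_ae ?_) (e.trans (integral_congr_ae ?_))
  · filter_upwards [hθ₁.coeFn_fourier_windowedSpectrum hF h x h₁,
      hθ₂.coeFn_fourier_windowedSpectrum hF f x h₂] with ξ e₁ e₂
    rw [e₁, e₂, RCLike.inner_apply, inner_conj_symm]
  · filter_upwards [h₁.coeFn_toLp, h₂.coeFn_toLp] with t e₁ e₂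
    rw [e₁, e₂, RCLike.inner_apply]

lemma orthogonality_of_stronglyMeasurable (hF : IsWarpingFunction D F)
    (hθ₁ : IsPrototype D F θ₁) (hθ₂ : IsPrototype D F θ₂) (hm₁ : StronglyMeasurable θ₁)
    (hm₂ : StronglyMeasurable θ₂) {h : L2} (hh : h ∈ bandSpace D) (f : L2) :
    Integrable (fun p => inner ℂ h (warpedAtom D F θ₁ p) * inner ℂ (warpedAtom D F θ₂ p) f)
      (phaseMeasure D) ∧
    ∫ p, inner ℂ h (warpedAtom D F θ₁ p) * inner ℂ (warpedAtom D F θ₂ p) f ∂(phaseMeasure D) =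
      l2Inner θ₁ θ₂ * inner ℂ h f := by
  have := hF.sigmaFinite_comap
  have hint : Integrable (fun p => inner ℂ h (warpedAtom D F θ₁ p) *
      inner ℂ (warpedAtom D F θ₂ p) f) (phaseMeasure D) := by
    refine ((hθ₁.memLp_inner_warpedAtom hF hm₁ h).integrable_mul
      (hθ₂.memLp_inner_warpedAtom hF hm₂ f).star).congr (Filter.Eventually.of_forall fun p => ?_)
    simp only [Pi.mul_apply, Pi.star_apply, RCLike.star_def, inner_conj_symm]
  have hintB : Integrable (fun q : D × ℝ => windowedSpectrum D F θ₁ h q.1 q.2 *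
      conj (windowedSpectrum D F θ₂ f q.1 q.2)) (phaseMeasure D) :=
    (hθ₁.memLp_windowedSpectrum hF hm₁ h).integrable_mul
      (hθ₂.memLp_windowedSpectrum hF hm₂ f).star
  refine ⟨hint, ?_⟩
  rw [phaseMeasure] at hint hintB ⊢
  rw [integral_prod _ hint]
  calc _ = ∫ x : D, (∫ t : ℝ, windowedSpectrum D F θ₁ h x t *
            conj (windowedSpectrum D F θ₂ f x t)) ∂(Measure.comap ((↑) : D → ℝ) volume) := by
        refine integral_congr_ae ?_
        filter_upwards [hθ₁.ae_memLp_windowedSpectrum hF hm₁ h,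
          hθ₂.ae_memLp_windowedSpectrum hF hm₂ f] with x h₁ h₂
        exact integral_inner_mul_inner_warpedAtom hF hθ₁ hθ₂ h f x h₁ h₂
    _ = ∫ t, ∫ x : D, windowedSpectrum D F θ₁ h x t * conj (windowedSpectrum D F θ₂ f x t)
          ∂(Measure.comap ((↑) : D → ℝ) volume) := integral_integral_swap hintB
    _ = ∫ t, l2Inner θ₁ θ₂ * ((𝓕 f : L2) t * conj ((𝓕 h : L2) t)) := by
        refine integral_congr_ae ?_
        -- For `t ∉ D` the windows carry no information; the identity survives there because `𝓕 h`
        -- vanishes.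
        have hh' : ∀ᵐ t, t ∉ D → (𝓕 h : L2) t = 0 := hh
        filter_upwards [hh'] with t ht
        by_cases htD : t ∈ D
        · rw [← integral_warpedWindow_mul_conj hF θ₁ θ₂ htD, ← integral_mul_const]
          refine integral_congr_ae (Filter.Eventually.of_forall fun x => ?_)
          simp only [windowedSpectrum, map_mul, Complex.conj_conj]
          ring
        · simp [windowedSpectrum, ht htD]
    _ = l2Inner θ₁ θ₂ * inner ℂ h f := by
        rw [integral_const_mul, ← Lp.inner_fourier_eq h f, L2.inner_def]
        rfl

/-- Orthogonality relations for warped time-frequency systems. -/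
lemma orthogonality (hF : IsWarpingFunction D F) (hθ₁ : IsPrototype D F θ₁)
    (hθ₂ : IsPrototype D F θ₂) {h : L2} (hh : h ∈ bandSpace D) (f : L2) :
    Integrable (fun p => inner ℂ h (warpedAtom D F θ₁ p) * inner ℂ (warpedAtom D F θ₂ p) f)
      (phaseMeasure D) ∧
    ∫ p, inner ℂ h (warpedAtom D F θ₁ p) * inner ℂ (warpedAtom D F θ₂ p) f ∂(phaseMeasure D) =
      l2Inner θ₁ θ₂ * inner ℂ h f := by
  obtain ⟨η₁, hm₁, h₁⟩ := hθ₁.2.aestronglyMeasurable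
  obtain ⟨η₂, hm₂, h₂⟩ := hθ₂.2.aestronglyMeasurable
  have hl : l2Inner θ₁ θ₂ = l2Inner η₁ η₂ := integral_congr_ae (by
    filter_upwards [h₁, h₂] with t e₁ e₂
    rw [e₁, e₂])
  rw [warpedAtom_congr_ae hF h₁, warpedAtom_congr_ae hF h₂, hl]
  exact orthogonality_of_stronglyMeasurable hF (hθ₁.congr_ae h₁) (hθ₂.congr_ae h₂) hm₁ hm₂ hh f

lemma l2Inner_self (θ : ℝ → ℂ) : l2Inner θ θ = (frameBound θ : ℂ) := by
  rw [l2Inner, frameBound, ← integral_complex_ofReal]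
  refine integral_congr_ae (Filter.Eventually.of_forall fun t => ?_)
  simp only [Complex.mul_conj, Complex.normSq_eq_norm_sq]

lemma IsPrototype.frameBound_pos (hθ : IsPrototype D F θ) (h : ¬ θ =ᵐ[volume] 0) :
    0 < frameBound θ := by
  refine (integral_pos_iff_support_of_nonneg (fun t => sq_nonneg _)
    ((memLp_two_iff_integrable_sq_norm hθ.2.aestronglyMeasurable).1 hθ.2)).2 ?_
  rw [pos_iff_ne_zero]
  intro h0
  refine h ?_
  filter_upwards [compl_mem_ae_iff.2 h0] with t ht
  simpa using ht

lemma not_ae_eq_zero_left (h : l2Inner θ₁ θ₂ ≠ 0) : ¬ θ₁ =ᵐ[volume] 0 := fun h0 => h (by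
  rw [l2Inner]
  exact integral_eq_zero_of_ae (h0.mono fun t ht => by simp [ht]))

lemma not_ae_eq_zero_right (h : l2Inner θ₁ θ₂ ≠ 0) : ¬ θ₂ =ᵐ[volume] 0 := fun h0 => h (by
  rw [l2Inner]
  exact integral_eq_zero_of_ae (h0.mono fun t ht => by simp [ht]))

lemma IsPrototype.isTightFamily (hF : IsWarpingFunction D F) (hθ : IsPrototype D F θ)
    (h : ¬ θ =ᵐ[volume] 0) :
    IsTightFamily (phaseMeasure D) (bandSpace D) (warpedAtom D F θ) (frameBound θ) where
  stronglyMeasurable := hθ.stronglyMeasurable_warpedAtom hF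
  mem := hθ.warpedAtom_mem hF
  pos := hθ.frameBound_pos h
  integrable _ hh f _ := (orthogonality hF hθ hθ hh f).1
  reproduce h hh f _ := by rw [(orthogonality hF hθ hθ hh f).2, l2Inner_self]

/-- The composition of the kernels of two warped systems. -/
lemma l2Inner_mul_warpedMixedKernel (hF : IsWarpingFunction D F) (hθ₁ : IsPrototype D F θ₁)
    (hθ₂ : IsPrototype D F θ₂) (p q : D × ℝ) :
    l2Inner θ₁ θ₂ * warpedMixedKernel D F θ₁ θ₂ p q =
      ∫ r, mixedKernel (warpedAtom D F θ₁) (warpedAtom D F θ₁) p r *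
        mixedKernel (warpedAtom D F θ₂) (warpedAtom D F θ₂) r q ∂(phaseMeasure D) :=
  (orthogonality hF hθ₁ hθ₂ (hθ₁.warpedAtom_mem hF p) (warpedAtom D F θ₂ q)).2.symm

lemma memKernelAlgebra_mixedKernel_self {m : D × ℝ → D × ℝ → ℝ} (hA : frameBound θ ≠ 0)
    (hK : MemKernelAlgebra (phaseMeasure D) m (warpedKernel D F θ)) :
    MemKernelAlgebra (phaseMeasure D) m (mixedKernel (warpedAtom D F θ) (warpedAtom D F θ)) := by
  have h := hK.const_mul (frameBound θ : ℂ)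
  have e : (fun x y => (frameBound θ : ℂ) * warpedKernel D F θ x y) =
      mixedKernel (warpedAtom D F θ) (warpedAtom D F θ) := by
    ext x y
    exact mul_inv_cancel_left₀ (Complex.ofReal_ne_zero.2 hA) _
  rwa [e] at h

/-- Dividing the composition formula by `⟨θ₁, θ₂⟩` dominates the mixed kernel by a composition of
two kernels of `𝒜_m`. -/
lemma memKernelAlgebra_mixedKernel_of_l2Inner_ne_zero (hF : IsWarpingFunction D F)
    {m : D × ℝ → D × ℝ → ℝ} (hm : IsAdmissibleWeight m)
    (hθ₁ : IsPrototype D F θ₁) (hθ₂ : IsPrototype D F θ₂) (h : l2Inner θ₁ θ₂ ≠ 0)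
    (hK₁ : MemKernelAlgebra (phaseMeasure D) m
      (mixedKernel (warpedAtom D F θ₁) (warpedAtom D F θ₁)))
    (hK₂ : MemKernelAlgebra (phaseMeasure D) m
      (mixedKernel (warpedAtom D F θ₂) (warpedAtom D F θ₂))) :
    MemKernelAlgebra (phaseMeasure D) m
      (mixedKernel (warpedAtom D F θ₁) (warpedAtom D F θ₂)) := by
  have := hF.sigmaFinite_comap
  have : SFinite (phaseMeasure D) := by rw [phaseMeasure]; infer_instance
  have h₁ := hθ₁.stronglyMeasurable_warpedAtom hF
  have h₂ := hθ₂.stronglyMeasurable_warpedAtom hF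
  refine MemKernelAlgebra.of_le_comp hm (c := ‖(l2Inner θ₁ θ₂)⁻¹‖ₑ) enorm_ne_top
    (stronglyMeasurable_mixedKernel h₁ h₂) (stronglyMeasurable_mixedKernel h₁ h₁)
    (stronglyMeasurable_mixedKernel h₂ h₂) hK₁ hK₂ fun p q => ?_
  have e : mixedKernel (warpedAtom D F θ₁) (warpedAtom D F θ₂) p q =
      (l2Inner θ₁ θ₂)⁻¹ * (l2Inner θ₁ θ₂ * warpedMixedKernel D F θ₁ θ₂ p q) :=
    (inv_mul_cancel_left₀ h _).symm
  rw [e, l2Inner_mul_warpedMixedKernel hF hθ₁ hθ₂, enorm_mul]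
  refine mul_le_mul_right ((enorm_integral_le_lintegral_enorm _).trans (le_of_eq ?_)) _
  simp_rw [enorm_mul]

end Orthogonality

end WarpedCoorbit

end

theorem mainTheorem7 (D : Set ℝ) (F : ℝ → ℝ) (hF : IsWarpingFunction D F)
    (m : D × ℝ → D × ℝ → ℝ) (hm : IsAdmissibleWeight m)
    (θ₁ θ₂ : ℝ → ℂ)
    (hθ₁ : IsPrototype D F θ₁) (hθ₂ : IsPrototype D F θ₂)
    (hK₁ : MemKernelAlgebra (phaseMeasure D) m (warpedKernel D F θ₁))
    (hK₂ : MemKernelAlgebra (phaseMeasure D) m (warpedKernel D F θ₂))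
    -- satisfied by `θ₀ = θ₁` as soon as `⟨θ₁, θ₂⟩ ≠ 0`
    (hlink : ∃ θ₀ : ℝ → ℂ, IsPrototype D F θ₀ ∧
      MemKernelAlgebra (phaseMeasure D) m (warpedKernel D F θ₀) ∧
      l2Inner θ₁ θ₀ ≠ 0 ∧ l2Inner θ₀ θ₂ ≠ 0) :
    (∀ p q : D × ℝ,
      l2Inner θ₁ θ₂ * warpedMixedKernel D F θ₁ θ₂ p q =
        (frameBound θ₁ * frameBound θ₂ : ℂ) *
          kernelComp (phaseMeasure D) (warpedKernel D F θ₁)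
            (warpedKernel D F θ₂) p q) ∧
    MemKernelAlgebra (phaseMeasure D) m (warpedMixedKernel D F θ₁ θ₂) ∧
    ∀ (Y : Type*) [NormedAddCommGroup Y] [NormedSpace ℂ Y]
      (ι : Y →ₗ[ℂ] ((D × ℝ) →ₘ[phaseMeasure D] ℂ)),
      IsSolidSpace ι → KernelAlgebraActs m ι → ∀ z : D × ℝ,
        coorbit (bandSpace D) (warpedAtom D F θ₁) m z ι =
          coorbit (bandSpace D)
            (warpedAtom D F θ₂) m z ι ∧
        ∃ C : ℝ, ∀ T ∈ coorbit (bandSpace D)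
            (warpedAtom D F θ₁) m z ι,
          ∀ G₁ G₂ : Y, ι G₁ =ᵐ[phaseMeasure D] voice (warpedAtom D F θ₁) T →
            ι G₂ =ᵐ[phaseMeasure D] voice (warpedAtom D F θ₂) T →
            ‖G₁‖ ≤ C * ‖G₂‖ ∧ ‖G₂‖ ≤ C * ‖G₁‖ := by
  obtain ⟨θ₀, hθ₀, hK₀, h₁₀, h₀₂⟩ := hlink
  have := hF.sigmaFinite_comap
  have : SFinite (phaseMeasure D) := by rw [phaseMeasure]; infer_instance
  -- The two nonvanishing inner products also force all three prototypes to be nonzero, so that each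
  -- generates a tight frame.
  have n₁ := not_ae_eq_zero_left h₁₀
  have n₀ := not_ae_eq_zero_right h₁₀
  have n₂ := not_ae_eq_zero_right h₀₂
  have t₁ := hθ₁.isTightFamily hF n₁
  have t₀ := hθ₀.isTightFamily hF n₀
  have t₂ := hθ₂.isTightFamily hF n₂
  have k₁ := memKernelAlgebra_mixedKernel_self t₁.pos.ne' hK₁
  have k₀ := memKernelAlgebra_mixedKernel_self t₀.pos.ne' hK₀
  have k₂ := memKernelAlgebra_mixedKernel_self t₂.pos.ne' hK₂
  -- When `⟨θ₁, θ₂⟩ = 0` the composition formula gives no hold on `K₁₂`; the reproducing formula of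
  -- `θ₀` expresses it through `K₁₀` and `K₀₂` instead.
  have k₁₂ : MemKernelAlgebra (phaseMeasure D) m (warpedMixedKernel D F θ₁ θ₂) :=
    t₀.memKernelAlgebra_mixedKernel hm t₁.stronglyMeasurable t₂.stronglyMeasurable t₁.mem t₂.mem
      (memKernelAlgebra_mixedKernel_of_l2Inner_ne_zero hF hm hθ₁ hθ₀ h₁₀ k₁ k₀)
      (memKernelAlgebra_mixedKernel_of_l2Inner_ne_zero hF hm hθ₀ hθ₂ h₀₂ k₀ k₂)
  refine ⟨fun p q => ?_, k₁₂, fun Y _ _ ι hι hacts z =>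
    coorbit_eq_and_norm_equiv hm t₁ t₂ k₁ k₂ k₁₂ hι.injective hacts z⟩
  rw [l2Inner_mul_warpedMixedKernel hF hθ₁ hθ₂, kernelComp, ← integral_const_mul]
  refine integral_congr_ae (Filter.Eventually.of_forall fun r => ?_)
  have a₁ : (frameBound θ₁ : ℂ) ≠ 0 := Complex.ofReal_ne_zero.2 t₁.pos.ne'
  have a₂ : (frameBound θ₂ : ℂ) ≠ 0 := Complex.ofReal_ne_zero.2 t₂.pos.ne'
  simp only [warpedKernel, frameKernel, mixedKernel]
  field_simp
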